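/- Consider a network of $C$ cells and $L$ routes. Route $l$ has $N_l$ stages, located in cells $c(l,1),\dots,c(l,N_l)$. New sessions of route $l$ start according to a homogeneous Poisson process on $\mathbb R$ of rate $\lambda_{l0}>0$. Each session of route $l$ carries a session duration $T_l>0$ and dwell times $\tau_{l1},\dots,\tau_{lN_l}>0$ with an arbitrary joint law (no independence is assumed between $T_l$ and the $\tau_{lj}$); the data of different sessions of a route are i.i.d. and independent of the arrival times, and different routes are independent. Write $S_{lj}=\sum_{i<j}\tau_{li}$. Stage $j$ exists for a session if $T_l>S_{lj}$; then the user is in cell $c(l,j)$ from time $S_{lj}$ after the start of the session, for the channel holding time $t_{lj}=\min\{T_l-S_{lj},\tau_{lj}\}$. Assume $E[t_{lj};T_l>S_{lj}]<\infty$ for all $l,j$. Let $$\bar\lambda_n=\sum_{(l,j):c(l,j)=n}\lambda_{l0}\,P(T_l>S_{lj}),\qquad \bar t_n=\frac1{\bar\lambda_n}\sum_{(l,j):c(l,j)=n}\lambda_{l0}\,E[t_{lj};T_l>S_{lj}]$$ be the average total arrival rate to cell $n$ and the average channel holding time in cell $n$ (with $\bar t_n=0$ if $\bar\lambda_n=0$),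 and let $y_n(t)$ be the number of users in cell $n$ at time $t$. Put $$\pi_1(y)=\prod_{n=1}^C e^{-\bar\lambda_n\bar t_n}\,\frac{(\bar\lambda_n\bar t_n)^{y_n}}{y_n!},\qquad y\in\mathbb N^C .$$ Then: 1. at every time $t$ the vector $(y_1(t),\dots,y_C(t))$ has distribution $\pi_1$; that is, the numbers of users in the cells are independent Poisson random variables with means $\bar\lambda_n\bar t_n$; 2. if instead the network is empty at time $0$ and only sessions that start after time $0$ are counted, then for each $y$ the probability that the vector of user numbers at time $t$ equals $y$ converges to $\pi_1(y)$ as $t\to\infty$; 3. the distribution is insensitive: any two such networks on the same cells (with arbitrary routes and arbitrary, possibly dependent, holding times) that have the same $\bar\lambda_n$ and the same $\bar t_n$ for all $n$ have the same stationary user distribution; 4. $\pi_1$ is the unique stationary distribution (probability solution of the global balance equations) of every open Jackson network of $C$ $M/M/\infty$ queues (nonnegative external arrival rates, substochastic routing matrix from which every customer can eventually leave, positive service rates) whose total arrival rates solving the traffic equations are $\bar\lambda_n$ and whose mean service time is $\bar t_n$ at each queue $n$ with $\bar\lambda_n>0$; such a Jackson network exists. -/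

import Mathlib

open MeasureTheory ProbabilityTheory Filter Topology
open scoped NNReal ENNReal Nat

/-- The data carried by one session on a route with `N` stages: the session duration `T` and the
cell dwell times `τ 0, …, τ (N - 1)` (the first one being the residual dwell time in the cell where
the session starts). -/
abbrev Session (N : ℕ) : Type := ℝ × (Fin N → ℝ)

namespace Session

variable {N : ℕ}

/-- The session duration. -/
def duration (s : Session N) : ℝ := s.1

/-- The dwell time in the cell of stage `j`. -/
def dwell (s : Session N) (j : Fin N) : ℝ := s.2 j

/-- Time between the start of the session and the start of stage `j`. -/
def stageStart (s : Session N) (j : Fin N) : ℝ := ∑ i ∈ Finset.Iio j, s.dwell i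

/-- Stage `j` exists: the session is still active when stage `j` starts. -/
def Reaches (s : Session N) (j : Fin N) : Prop := s.stageStart j < s.duration

/-- The channel holding time in stage `j` (meaningful when stage `j` exists). -/
def holdingTime (s : Session N) (j : Fin N) : ℝ :=
  min (s.duration - s.stageStart j) (s.dwell j)

/-- A session that started `age` time units ago is now in stage `j`. -/
def InStage (s : Session N) (j : Fin N) (age : ℝ) : Prop :=
  s.Reaches j ∧ s.stageStart j ≤ age ∧ age < s.stageStart j + s.holdingTime j

end Session

/-- A cellular network with `C` cells. -/
structure CellularNetwork (C : ℕ) where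
  /-- number of routes -/
  L : ℕ
  /-- number of stages of each route -/
  N : Fin L → ℕ
  /-- `cell l j` is the cell of the `j`-th stage of route `l` -/
  cell : (l : Fin L) → Fin (N l) → Fin C
  /-- new session arrival rate of each route -/
  rate : Fin L → ℝ≥0
  rate_pos : ∀ l, 0 < rate l
  /-- joint law of the session duration and of the dwell times on each route -/
  law : (l : Fin L) → Measure (Session (N l))
  law_prob : ∀ l, IsProbabilityMeasure (law l)
  /-- durations and dwell times are positive -/
  law_pos : ∀ l, ∀ᵐ s ∂(law l), 0 < s.duration ∧ ∀ j, 0 < s.dwell j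
  /-- channel holding times have finite mean -/
  integrable_holdingTime : ∀ l j,
    IntegrableOn (fun s : Session (N l) => s.holdingTime j) {s | s.Reaches j} (law l)

namespace CellularNetwork

variable {C : ℕ} (M : CellularNetwork C)

/-- Average total arrival rate (new sessions and handoffs) at cell `n`: the sum, over the stages
`(l, j)` located in cell `n`, of the rate of the sessions of route `l` that reach stage `j`. -/
noncomputable def arrivalRate (n : Fin C) : ℝ :=
  ∑ l, ∑ j, if M.cell l j = n then (M.rate l : ℝ) * (M.law l).real {s | s.Reaches j} else 0

/-- Average channel holding time in cell `n` over all routes and stages; the mean holding time of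
each stage located in cell `n` is weighted by the arrival rate at this stage.
It is `0` (as `0 / 0`) when no session ever visits cell `n`. -/
noncomputable def meanHoldingTime (n : Fin C) : ℝ :=
  (∑ l, ∑ j, if M.cell l j = n then
      (M.rate l : ℝ) * ∫ s in {s : Session (M.N l) | s.Reaches j}, s.holdingTime j ∂(M.law l)
    else 0) / M.arrivalRate n

/-- The product-form distribution with Poisson marginals of mean `arrivalRate * meanHoldingTime`. -/
noncomputable def productPoisson (y : Fin C → ℕ) : ℝ :=
  ∏ n, Real.exp (-(M.arrivalRate n * M.meanHoldingTime n)) *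
    (M.arrivalRate n * M.meanHoldingTime n) ^ (y n) / (y n)!

end CellularNetwork

/-- `arr` enumerates the points of a homogeneous Poisson process of intensity `r` on `ℝ`. -/
structure IsPoissonProcess {Ω : Type*} [MeasurableSpace Ω] (P : Measure Ω) (r : ℝ≥0)
    (arr : ℕ → Ω → ℝ) : Prop where
  measurable : ∀ k, Measurable (arr k)
  hasLaw_count : ∀ B : Set ℝ, MeasurableSet B → volume B < ∞ →
    HasLaw (fun ω => {k | arr k ω ∈ B}.encard)
      ((poissonMeasure (r * (volume B).toNNReal)).map (fun i : ℕ => (i : ℕ∞))) P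
  indep_count : ∀ (m : ℕ) (B : Fin m → Set ℝ), (∀ i, MeasurableSet (B i)) →
    (∀ i, volume (B i) < ∞) → Pairwise (fun i j => Disjoint (B i) (B j)) →
    iIndepFun (fun i ω => {k | arr k ω ∈ B i}.encard) P

namespace CellularNetwork

variable {C : ℕ} (M : CellularNetwork C)

/-- The traffic offered to the network: on route `l`, session `k` starts at time `arr l k` and
carries the data `ses l k`. New sessions of each route form a Poisson process, the sessions of a
route are i.i.d. and independent of their arrival times, and the routes are independent. -/
structure IsTraffic {Ω : Type*} [MeasurableSpace Ω] (P : Measure Ω)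
    (arr : Fin M.L → ℕ → Ω → ℝ) (ses : (l : Fin M.L) → ℕ → Ω → Session (M.N l)) : Prop where
  poisson : ∀ l, IsPoissonProcess P (M.rate l) (arr l)
  measurable_ses : ∀ l k, Measurable (ses l k)
  hasLaw_ses : ∀ l k, HasLaw (ses l k) (M.law l) P
  indep_ses : ∀ l, iIndepFun (fun k => ses l k) P
  indep_arr_ses : ∀ l, IndepFun (fun ω k => arr l k ω) (fun ω k => ses l k ω) P
  indep_routes : iIndepFun
    (β := fun l => (ℕ → ℝ) × (ℕ → Session (M.N l)))
    (fun l ω => (fun k => arr l k ω, fun k => ses l k ω)) P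

/-- The number of users in cell `n` at time `t`, among the sessions that started at a time in `A`.
With `A = Set.univ` the network has been operating forever; with `A = Set.Ioi 0` it is empty at
time `0`. -/
noncomputable def userCount {Ω : Type*} (arr : Fin M.L → ℕ → Ω → ℝ)
    (ses : (l : Fin M.L) → ℕ → Ω → Session (M.N l)) (A : Set ℝ) (t : ℝ) (n : Fin C) (ω : Ω) : ℕ∞ :=
  {p : ((l : Fin M.L) × Fin (M.N l)) × ℕ | M.cell p.1.1 p.1.2 = n ∧ arr p.1.1 p.2 ω ∈ A ∧
    (ses p.1.1 p.2 ω).InStage p.1.2 (t - arr p.1.1 p.2 ω)}.encard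

end CellularNetwork

/-- An open Jackson network of `C` queues, each with infinitely many independent exponential
servers (`M/M/∞` queues). -/
structure OpenJacksonNetwork (C : ℕ) where
  /-- external arrival rates -/
  ext : Fin C → ℝ
  /-- routing probabilities -/
  route : Matrix (Fin C) (Fin C) ℝ
  /-- service rate of each server -/
  serviceRate : Fin C → ℝ
  ext_nonneg : ∀ n, 0 ≤ ext n
  route_nonneg : ∀ n m, 0 ≤ route n m
  route_sum_le : ∀ n, ∑ m, route n m ≤ 1
  serviceRate_pos : ∀ n, 0 < serviceRate n
  /-- from every queue, a customer can eventually leave the network -/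
  isOpen : ∀ n, ∃ k : ℕ, ∑ m, (route ^ k) n m < 1

namespace OpenJacksonNetwork

variable {C : ℕ} (J : OpenJacksonNetwork C)

/-- Transition rate from the state `x` to the state `y`: external arrivals, departures, and moves
from a queue `n` to a queue `m`. (A customer fed back to the same queue is a jump from `x` to `x`,
which contributes equally to both sides of the balance equations.) -/
noncomputable def transitionRate (x y : Fin C → ℕ) : ℝ :=
  (∑ n, if y = x + Pi.single n 1 then J.ext n else 0) +
  (∑ n, if y + Pi.single n 1 = x then
      J.serviceRate n * x n * (1 - ∑ m, J.route n m) else 0) +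
  (∑ n, ∑ m, if y + Pi.single n 1 = x + Pi.single m 1 then
      J.serviceRate n * x n * J.route n m else 0)

/-- `p` is a stationary distribution: a probability distribution satisfying the global balance
equations. Both sums have finitely many nonzero terms. -/
def IsStationary (p : (Fin C → ℕ) → ℝ) : Prop :=
  (∀ x, 0 ≤ p x) ∧ HasSum p 1 ∧
    ∀ x, ∑' z, p z * J.transitionRate z x = p x * ∑' z, J.transitionRate x z

/-- The total arrival rates (solution of the traffic equations) of the Jackson network are `lam`,
and its mean service times are `tbar` (at every queue that is visited at all). -/
def Matches (lam tbar : Fin C → ℝ) : Prop :=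
  (∀ n, lam n = J.ext n + ∑ m, lam m * J.route m n) ∧
    ∀ n, 0 < lam n → 1 / J.serviceRate n = tbar n

end OpenJacksonNetwork

/-! The sessions of a route, marked with their data, form a Poisson process on (starting time) ×
(session data) with intensity `rate` · dx ⊗ `law`. The users in stage j at time t are the points of
this process in the set `inStageSet`. Dwell times are positive, so a session is almost surely in at
most one stage at a time. The sets of the different stages of a route are therefore disjoint up to
null sets, and their counts are independent Poisson variables, whatever the dependence between the
durations. For fixed data, the admissible starting times fill an interval as long as the holding
time. By Fubini the mean count is thus `rate` · E[holding time; stage reached], and adding the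
stages located in a cell gives `arrivalRate * meanHoldingTime`. Insensitivity is immediate. For a
network empty at time 0 the starting times are restricted to (0, ∞), and the means converge by
dominated convergence.

The argument runs through Laplace transforms with values in [0, ∞], where infinite counts need no
separate treatment. `IsPoissonProcess.lintegral_expNeg_tsum_mark` computes the functional of the
marked process, and `Measure.ext_of_lintegral_expNeg` recovers the law from it.

For Jackson networks, the traffic equations turn global balance for the Poisson product into an
identity (`Matches.hasSum_flow`). Uniqueness comes from `GlobalBalance.exists_eq_const_mul`: the
minimum of two stationary measures is excessive, hence stationary when its total flow is finite. The
empty state is reachable from everywhere, so irreducibility is not needed. -/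

/-! ### The exponential exp(-x) on [0, ∞] -/

namespace ENNReal

/-- The function `x ↦ exp (-x)` from `[0, ∞]` to `[0, ∞]`, with `exp (-∞) = 0`. -/
noncomputable def expNeg (x : ℝ≥0∞) : ℝ≥0∞ := EReal.exp (-(x : EReal))

lemma expNeg_coe (x : ℝ≥0) : expNeg x = ENNReal.ofReal (Real.exp (-x)) := by
  have : (((x : ℝ≥0∞) : EReal)) = ((x : ℝ) : EReal) := rfl
  rw [expNeg, this, ← EReal.coe_neg, EReal.exp_coe]

@[simp] lemma expNeg_zero : expNeg 0 = 1 := by simp [expNeg]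

@[simp] lemma expNeg_top : expNeg ∞ = 0 := by simp [expNeg]

lemma expNeg_add (x y : ℝ≥0∞) : expNeg (x + y) = expNeg x * expNeg y := by
  induction x with
  | top => simp
  | coe x =>
    induction y with
    | top => simp
    | coe y =>
      rw [← ENNReal.coe_add, expNeg_coe, expNeg_coe, expNeg_coe,
        ← ENNReal.ofReal_mul (Real.exp_nonneg _), ← Real.exp_add]
      congr 2
      push_cast
      ring

lemma expNeg_antitone : Antitone expNeg := fun x y h => by
  rw [expNeg, expNeg, EReal.exp_le_exp_iff, EReal.neg_le_neg_iff]
  exact_mod_cast h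

lemma expNeg_le_one (x : ℝ≥0∞) : expNeg x ≤ 1 := by
  simpa using expNeg_antitone (zero_le (a := x))

lemma expNeg_ne_top (x : ℝ≥0∞) : expNeg x ≠ ∞ := ne_top_of_le_ne_top one_ne_top (expNeg_le_one x)

lemma continuous_expNeg : Continuous expNeg :=
  ENNReal.continuous_exp.comp (continuous_neg.comp continuous_coe_ennreal_ereal)

lemma measurable_expNeg : Measurable expNeg := continuous_expNeg.measurable

lemma expNeg_injective : Function.Injective expNeg := fun x y h => by
  have := EReal.exp_strictMono.injective h
  simpa using this

lemma expNeg_sum {ι : Type*} (s : Finset ι) (f : ι → ℝ≥0∞) :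
    expNeg (∑ i ∈ s, f i) = ∏ i ∈ s, expNeg (f i) := by
  classical
  induction s using Finset.induction_on with
  | empty => simp
  | insert i s hi ih => rw [Finset.sum_insert hi, Finset.prod_insert hi, expNeg_add, ih]

lemma expNeg_nsmul (n : ℕ) (x : ℝ≥0∞) : expNeg (x * n) = expNeg x ^ n := by
  induction n with
  | zero => simp
  | succ n ih => rw [Nat.cast_succ, mul_add, mul_one, expNeg_add, ih, pow_succ]

lemma tendsto_expNeg_sum_range (f : ℕ → ℝ≥0∞) :
    Tendsto (fun K => ∏ k ∈ Finset.range K, expNeg (f k)) atTop (𝓝 (expNeg (∑' k, f k))) := by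
  simp_rw [← expNeg_sum]
  exact (continuous_expNeg.tendsto _).comp ENNReal.summable.hasSum.tendsto_sum_nat

/-- A right inverse of `expNeg` on `[0, 1]`. -/
noncomputable def negLog (x : ℝ≥0∞) : ℝ≥0∞ := (-(ENNReal.log x)).toENNReal

lemma measurable_negLog : Measurable negLog :=
  measurable_ereal_toENNReal.comp (continuous_neg.measurable.comp ENNReal.measurable_log)

lemma expNeg_negLog {x : ℝ≥0∞} (hx : x ≤ 1) : expNeg (negLog x) = x := by
  rw [expNeg, negLog, EReal.coe_toENNReal, neg_neg, ENNReal.exp_log]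
  rw [EReal.le_neg]
  simpa using hx

end ENNReal

/-! ### Laplace transform of a Poisson variable -/

open ENNReal

/-- This is the Poisson generating function at q = exp(-c). The value c = ∞ is covered, with q = 0
and 0 ^ 0 = 1. -/
lemma lintegral_expNeg_mul_poissonMeasure (a : ℝ≥0) (c : ℝ≥0∞) :
    ∫⁻ i, expNeg (c * i) ∂(poissonMeasure a) = expNeg (a * (1 - expNeg c)) := by
  obtain ⟨q, hq⟩ : ∃ q : ℝ≥0, expNeg c = q := ⟨_, (ENNReal.coe_toNNReal (expNeg_ne_top c)).symm⟩
  have hq1 : q ≤ 1 := by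
    have := expNeg_le_one c
    rw [hq] at this
    exact_mod_cast this
  have key : HasSum (fun n : ℕ => Real.exp (-a) * a ^ n / (n)! * (q : ℝ) ^ n)
      (Real.exp (-(a * (1 - q) : ℝ≥0))) := by
    have h := (NormedSpace.expSeries_div_hasSum_exp ((a : ℝ) * q)).mul_left (Real.exp (-a))
    rw [← Real.exp_eq_exp_ℝ, ← Real.exp_add] at h
    have h1 : -((a * (1 - q) : ℝ≥0) : ℝ) = -a + a * q := by
      rw [NNReal.coe_mul, NNReal.coe_sub hq1]
      push_cast
      ring
    have h2 : ∀ n : ℕ, Real.exp (-a) * (((a : ℝ) * q) ^ n / (n)!) =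
        Real.exp (-a) * a ^ n / (n)! * (q : ℝ) ^ n := fun n => by rw [mul_pow]; ring
    simp_rw [h2] at h
    rwa [h1]
  rw [hq, show (1 : ℝ≥0∞) - q = ((1 - q : ℝ≥0) : ℝ≥0∞) by push_cast; rfl, ← ENNReal.coe_mul,
    expNeg_coe, ← key.tsum_eq, ENNReal.ofReal_tsum_of_nonneg (fun n => by positivity) key.summable,
    lintegral_countable']
  refine tsum_congr fun n => ?_
  rw [expNeg_nsmul, hq, poissonMeasure_singleton, mul_comm, ENNReal.ofReal_mul (by positivity)]
  congr 1
  rw [ENNReal.ofReal_pow (by positivity), ENNReal.ofReal_coe_nnreal]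

lemma lintegral_expNeg_mul_map_poissonMeasure (a : ℝ≥0) (c : ℝ≥0∞) :
    ∫⁻ i, expNeg (c * ((i : ℕ∞) : ℝ≥0∞)) ∂((poissonMeasure a).map (fun i : ℕ => (i : ℕ∞))) =
      expNeg (a * (1 - expNeg c)) := by
  rw [lintegral_map .of_discrete .of_discrete, ← lintegral_expNeg_mul_poissonMeasure]
  simp

lemma measurable_encard_setOf {Ω ι : Type*} [MeasurableSpace Ω] [Countable ι]
    {p : ι → Ω → Prop} (hp : ∀ i, MeasurableSet {ω | p i ω}) :
    Measurable (fun ω => {i | p i ω}.encard) :=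
  measurable_encard.comp (measurable_set_iff.2 fun i => measurable_mem.2 (hp i))

lemma tsum_indicator_const_comp {ι α : Type*} (B : Set α) (c : ℝ≥0∞) (x : ι → α) :
    ∑' k, B.indicator (fun _ => c) (x k) = c * ({k | x k ∈ B}.encard : ℝ≥0∞) := by
  rw [← ENNReal.tsum_set_one, ← ENNReal.tsum_mul_left, mul_one,
    tsum_subtype {k | x k ∈ B} (fun _ => c)]
  rfl

/-! ### Laplace functional of a Poisson process -/

namespace IsPoissonProcess

variable {Ω : Type*} [MeasurableSpace Ω] {P : Measure Ω} {r : ℝ≥0} {arr : ℕ → Ω → ℝ}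

lemma measurable_count (h : IsPoissonProcess P r arr) {B : Set ℝ} (hB : MeasurableSet B) :
    Measurable (fun ω => {k | arr k ω ∈ B}.encard) :=
  measurable_encard_setOf fun k => h.measurable k hB

lemma lintegral_expNeg_count (h : IsPoissonProcess P r arr) {B : Set ℝ} (hB : MeasurableSet B)
    (hB' : volume B < ∞) (c : ℝ≥0∞) :
    ∫⁻ ω, expNeg (c * ({k | arr k ω ∈ B}.encard : ℝ≥0∞)) ∂P =
      expNeg (r * ((1 - expNeg c) * volume B)) := by
  have hl := h.hasLaw_count B hB hB'
  have := lintegral_map' (μ := P) (f := fun i : ℕ∞ => expNeg (c * (i : ℝ≥0∞)))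
    Measurable.of_discrete.aemeasurable hl.aemeasurable
  rw [← this, hl.map_eq, lintegral_expNeg_mul_map_poissonMeasure, ENNReal.coe_mul,
    ENNReal.coe_toNNReal hB'.ne]
  congr 1
  ring

lemma lintegral_expNeg_sum_count (h : IsPoissonProcess P r arr) {ι : Type*} [Fintype ι]
    {B : ι → Set ℝ} (hB : ∀ i, MeasurableSet (B i)) (hB' : ∀ i, volume (B i) < ∞)
    (hd : Pairwise (fun i j => Disjoint (B i) (B j))) (c : ι → ℝ≥0∞) :
    ∫⁻ ω, expNeg (∑ i, c i * ({k | arr k ω ∈ B i}.encard : ℝ≥0∞)) ∂P =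
      expNeg (r * ∑ i, (1 - expNeg (c i)) * volume (B i)) := by
  let e := Fintype.equivFin ι
  have hi := h.indep_count _ (fun i => B (e.symm i)) (fun i => hB _) (fun i => hB' _)
    (fun i j hij => hd (e.symm.injective.ne hij))
  have hi2 := hi.comp (fun i (n : ℕ∞) => expNeg (c (e.symm i) * (n : ℝ≥0∞)))
    (fun i => .of_discrete)
  have := lintegral_prod_eq_prod_lintegral_of_indepFun Finset.univ _ hi2
    (fun i => Measurable.of_discrete.comp (h.measurable_count (hB _)))
  simp only [Function.comp_apply] at this
  simp_rw [expNeg_sum]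
  rw [Finset.mul_sum, expNeg_sum]
  rw [← e.symm.prod_comp]
  simp_rw [← e.symm.prod_comp (fun i => expNeg (c i * _))]
  rw [this]
  exact Finset.prod_congr rfl fun i _ => h.lintegral_expNeg_count (hB _) (hB' _) _

/-- The Laplace functional of a Poisson process at a function with finitely many values. -/
lemma lintegral_expNeg_tsum_of_sum_indicator (h : IsPoissonProcess P r arr) {ι : Type*} [Fintype ι]
    {B : ι → Set ℝ} (hB : ∀ i, MeasurableSet (B i)) (hB' : ∀ i, volume (B i) < ∞)
    (hd : Pairwise (fun i j => Disjoint (B i) (B j))) (c : ι → ℝ≥0∞) :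
    ∫⁻ ω, expNeg (∑' k, ∑ i, (B i).indicator (fun _ => c i) (arr k ω)) ∂P =
      expNeg (r * ∫⁻ x, (1 - expNeg (∑ i, (B i).indicator (fun _ => c i) x))) := by
  -- By disjointness at most one summand is nonzero at each point, so x ↦ 1 - exp(-x), which
  -- vanishes at 0, passes through the sum.
  have h1 : ∀ x, 1 - expNeg (∑ i, (B i).indicator (fun _ => c i) x) =
      ∑ i, (B i).indicator (fun _ => 1 - expNeg (c i)) x := by
    intro x
    by_cases hx : ∃ i, x ∈ B i
    · obtain ⟨i, hi⟩ := hx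
      have hne : ∀ j, j ≠ i → x ∉ B j := fun j hj hxj => (hd hj).le_bot ⟨hxj, hi⟩
      rw [Finset.sum_eq_single i, Finset.sum_eq_single i] <;> simp_all
    · push Not at hx
      simp [hx]
  simp_rw [h1]
  rw [lintegral_finsetSum _ (fun i _ => measurable_const.indicator (hB i))]
  simp_rw [lintegral_indicator_const (hB _)]
  rw [← h.lintegral_expNeg_sum_count hB hB' hd]
  refine lintegral_congr fun ω => ?_
  congr 1
  rw [Summable.tsum_finsetSum (fun _ _ => ENNReal.summable)]
  exact Finset.sum_congr rfl fun i _ => tsum_indicator_const_comp _ _ _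

/-- The Laplace functional of a homogeneous Poisson process. -/
theorem lintegral_expNeg_tsum [IsProbabilityMeasure P] (h : IsPoissonProcess P r arr)
    {f : ℝ → ℝ≥0∞} (hf : Measurable f) :
    ∫⁻ ω, expNeg (∑' k, f (arr k ω)) ∂P = expNeg (r * ∫⁻ x, (1 - expNeg (f x))) := by
  -- Simple functions are cut off to bounded windows because the counts have a prescribed law only
  -- on sets of finite volume.
  let W : ℕ → Set ℝ := fun n => Set.Icc (-(n : ℝ)) n
  have hW : ∀ n, MeasurableSet (W n) := fun n => measurableSet_Icc
  let g : ℕ → ℝ → ℝ≥0∞ := fun n => (W n).indicator (SimpleFunc.eapprox f n)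
  have hg_eq : ∀ n x, g n x = ∑ c : (SimpleFunc.eapprox f n).range,
      (SimpleFunc.eapprox f n ⁻¹' {c.1} ∩ W n).indicator (fun _ => c.1) x := by
    intro n x
    by_cases hx : x ∈ W n
    · rw [Finset.sum_eq_single ⟨SimpleFunc.eapprox f n x, SimpleFunc.mem_range_self _ _⟩]
      · simp [g, hx]
      · intro c _ hc
        rw [Set.indicator_of_notMem]
        rintro ⟨h1, -⟩
        exact hc (Subtype.ext h1.symm)
      · simp
    · simp [g, hx]
  have hgn : ∀ n, ∫⁻ ω, expNeg (∑' k, g n (arr k ω)) ∂P =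
      expNeg (r * ∫⁻ x, (1 - expNeg (g n x))) := by
    intro n
    simp_rw [hg_eq]
    refine h.lintegral_expNeg_tsum_of_sum_indicator
      (fun c => (SimpleFunc.measurableSet_fiber _ _).inter (hW n))
      (fun c => (measure_mono Set.inter_subset_right).trans_lt (by simp [W])) ?_ _
    intro c d hcd
    refine Set.disjoint_left.2 ?_
    rintro x ⟨h1, -⟩ ⟨h2, -⟩
    exact hcd (Subtype.ext (h1.symm.trans h2))
  have hg_mono : Monotone g := by
    intro m n hmn x
    refine (Set.indicator_le_indicator (SimpleFunc.monotone_eapprox f hmn x)).trans ?_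
    refine Set.indicator_le_indicator_of_subset ?_ (fun _ => zero_le) x
    have : (m : ℝ) ≤ n := by exact_mod_cast hmn
    exact Set.Icc_subset_Icc (by linarith) this
  have hg_lim : ∀ x, Tendsto (fun n => g n x) atTop (𝓝 (f x)) := by
    intro x
    refine (SimpleFunc.tendsto_eapprox hf x).congr' ?_
    obtain ⟨N, hN⟩ := exists_nat_ge |x|
    filter_upwards [eventually_ge_atTop N] with n hn
    have : x ∈ W n := abs_le.1 (hN.trans (by exact_mod_cast hn))
    simp [g, this]
  have hg_meas : ∀ n, Measurable (g n) := fun n => (SimpleFunc.measurable _).indicator (hW n)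
  have hsum : ∀ ω, Tendsto (fun n => ∑' k, g n (arr k ω)) atTop (𝓝 (∑' k, f (arr k ω))) := by
    intro ω
    -- Monotone convergence for the counting measure on the indices of the points.
    have := lintegral_tendsto_of_tendsto_of_monotone (μ := Measure.count)
      (f := fun n k => g n (arr k ω)) (F := fun k => f (arr k ω))
      (fun n => Measurable.of_discrete.aemeasurable)
      (ae_of_all _ fun k m n hmn => hg_mono hmn _) (ae_of_all _ fun k => hg_lim _)
    simpa [lintegral_count] using this
  have hL : Tendsto (fun n => ∫⁻ ω, expNeg (∑' k, g n (arr k ω)) ∂P) atTop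
      (𝓝 (∫⁻ ω, expNeg (∑' k, f (arr k ω)) ∂P)) := by
    refine tendsto_lintegral_of_dominated_convergence (fun _ => 1) (fun n => ?_)
      (fun n => ae_of_all _ fun ω => expNeg_le_one _) (by simp)
      (ae_of_all _ fun ω => (continuous_expNeg.tendsto _).comp (hsum ω))
    exact measurable_expNeg.comp
      (Measurable.tsum fun k => (hg_meas n).comp (h.measurable k))
  have hR : Tendsto (fun n => expNeg (r * ∫⁻ x, (1 - expNeg (g n x)))) atTop
      (𝓝 (expNeg (r * ∫⁻ x, (1 - expNeg (f x))))) := by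
    refine (continuous_expNeg.tendsto _).comp (ENNReal.Tendsto.const_mul ?_ (.inr coe_ne_top))
    refine lintegral_tendsto_of_tendsto_of_monotone
      (fun n => (measurable_const.sub (measurable_expNeg.comp (hg_meas n))).aemeasurable)
      (ae_of_all _ fun x m n hmn => tsub_le_tsub_left (expNeg_antitone (hg_mono hmn x)) _)
      (ae_of_all _ fun x => ?_)
    exact ENNReal.Tendsto.sub tendsto_const_nhds ((continuous_expNeg.tendsto _).comp (hg_lim x))
      (.inl one_ne_top)
  exact tendsto_nhds_unique hL (by simpa only [hgn] using hR)

end IsPoissonProcess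

/-! ### Independent marking -/

section Marking

variable {Ω S : Type*} [MeasurableSpace Ω] [MeasurableSpace S] {P : Measure Ω}
  {ν : Measure S} {mark : ℕ → Ω → S}

/-- Independence factors the finite products, and domination by 1 gives the infinite one. Each
factor is rewritten through `negLog` so that the result is again the exponential of a sum over the
points, ready for the Laplace functional of the arrival times. -/
lemma lintegral_expNeg_tsum_of_iIndepFun [IsProbabilityMeasure P]
    (hm : ∀ k, Measurable (mark k)) (hν : ∀ k, HasLaw (mark k) ν P) (hi : iIndepFun mark P)
    {f : ℕ → S → ℝ≥0∞} (hf : ∀ k, Measurable (f k)) :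
    ∫⁻ ω, expNeg (∑' k, f k (mark k ω)) ∂P =
      expNeg (∑' k, negLog (∫⁻ s, expNeg (f k s) ∂ν)) := by
  have hprob : IsProbabilityMeasure ν := by
    rw [← (hν 0).map_eq]
    exact Measure.isProbabilityMeasure_map (hm 0).aemeasurable
  have hle : ∀ k, ∫⁻ s, expNeg (f k s) ∂ν ≤ 1 := fun k => by
    simpa using lintegral_mono (μ := ν) (fun s => expNeg_le_one (f k s))
  have hmeas : ∀ k, Measurable fun ω => expNeg (f k (mark k ω)) := fun k =>
    measurable_expNeg.comp ((hf k).comp (hm k))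
  have hfin : ∀ K, ∫⁻ ω, ∏ k ∈ Finset.range K, expNeg (f k (mark k ω)) ∂P =
      ∏ k ∈ Finset.range K, expNeg (negLog (∫⁻ s, expNeg (f k s) ∂ν)) := by
    intro K
    have h := lintegral_prod_eq_prod_lintegral_of_indepFun (Finset.range K) _
      (hi.comp (fun k s => expNeg (f k s)) (fun k => measurable_expNeg.comp (hf k))) hmeas
    refine h.trans (Finset.prod_congr rfl fun k _ => ?_)
    rw [expNeg_negLog (hle k), ← (hν k).map_eq,
      lintegral_map (f := fun s => expNeg (f k s)) (measurable_expNeg.comp (hf k)) (hm k)]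
    rfl
  refine tendsto_nhds_unique (f := fun K =>
    ∫⁻ ω, ∏ k ∈ Finset.range K, expNeg (f k (mark k ω)) ∂P) (l := atTop) ?_ ?_
  · refine tendsto_lintegral_of_dominated_convergence (fun _ => 1)
      (fun K => Finset.measurable_prod _ fun k _ => hmeas k)
      (fun K => ae_of_all _ fun ω => Finset.prod_le_one' fun k _ => expNeg_le_one _) (by simp)
      (ae_of_all _ fun ω => tendsto_expNeg_sum_range _)
  · simp_rw [hfin]
    exact tendsto_expNeg_sum_range _

/-- The Laplace functional of an independently marked homogeneous Poisson process. -/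
theorem IsPoissonProcess.lintegral_expNeg_tsum_mark [IsProbabilityMeasure P] {r : ℝ≥0}
    {arr : ℕ → Ω → ℝ} (h : IsPoissonProcess P r arr)
    (hm : ∀ k, Measurable (mark k)) (hν : ∀ k, HasLaw (mark k) ν P) (hi : iIndepFun mark P)
    (hind : IndepFun (fun ω k => arr k ω) (fun ω k => mark k ω) P)
    {F : ℝ × S → ℝ≥0∞} (hF : Measurable F) :
    ∫⁻ ω, expNeg (∑' k, F (arr k ω, mark k ω)) ∂P =
      expNeg (r * ∫⁻ x, ∫⁻ s, (1 - expNeg (F (x, s))) ∂ν) := by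
  have hprob : IsProbabilityMeasure ν := by
    rw [← (hν 0).map_eq]
    exact Measure.isProbabilityMeasure_map (hm 0).aemeasurable
  have hA : Measurable (fun ω k => arr k ω) := measurable_pi_iff.2 h.measurable
  have hS : Measurable (fun ω k => mark k ω) := measurable_pi_iff.2 hm
  have hFF : Measurable fun p : (ℕ → ℝ) × (ℕ → S) => expNeg (∑' k, F (p.1 k, p.2 k)) :=
    measurable_expNeg.comp (Measurable.tsum fun k => hF.comp (by fun_prop))
  have hG : Measurable fun x => negLog (∫⁻ s, expNeg (F (x, s)) ∂ν) :=
    measurable_negLog.comp (measurable_expNeg.comp hF).lintegral_prod_right'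
  have hle : ∀ x, ∫⁻ s, expNeg (F (x, s)) ∂ν ≤ 1 := fun x => by
    simpa using lintegral_mono (μ := ν) (fun s => expNeg_le_one (F (x, s)))
  have hmap := (indepFun_iff_map_prod_eq_prod_map_map hA.aemeasurable hS.aemeasurable).1 hind
  have := Measure.isProbabilityMeasure_map hS.aemeasurable (μ := P)
  calc ∫⁻ ω, expNeg (∑' k, F (arr k ω, mark k ω)) ∂P
      = ∫⁻ p, expNeg (∑' k, F (p.1 k, p.2 k))
          ∂(P.map fun ω => ((fun k => arr k ω), fun k => mark k ω)) :=
        (lintegral_map hFF (hA.prodMk hS)).symm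
    _ = ∫⁻ a, ∫⁻ m, expNeg (∑' k, F (a k, m k)) ∂(P.map fun ω k => mark k ω)
          ∂(P.map fun ω k => arr k ω) := by
        rw [hmap, lintegral_prod _ hFF.aemeasurable]
    -- With the arrival times frozen, the marks are integrated out first; what remains is a
    -- functional of the unmarked process.
    _ = ∫⁻ ω, expNeg (∑' k, negLog (∫⁻ s, expNeg (F (arr k ω, s)) ∂ν)) ∂P := by
        rw [lintegral_map hFF.lintegral_prod_right' hA]
        refine lintegral_congr fun ω => ?_
        rw [lintegral_map (f := fun m : ℕ → S => expNeg (∑' k, F (arr k ω, m k)))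
          (hFF.comp measurable_prodMk_left) hS]
        exact lintegral_expNeg_tsum_of_iIndepFun hm hν hi
          (f := fun k s => F (arr k ω, s)) (fun k => hF.comp measurable_prodMk_left)
    _ = expNeg (r * ∫⁻ x, ∫⁻ s, (1 - expNeg (F (x, s))) ∂ν) := by
        rw [h.lintegral_expNeg_tsum hG]
        congr 2
        refine lintegral_congr fun x => ?_
        rw [expNeg_negLog (hle x), lintegral_sub (g := fun s => expNeg (F (x, s)))
          (measurable_expNeg.comp (hF.comp measurable_prodMk_left))
          (ne_top_of_le_ne_top one_ne_top (hle x)) (ae_of_all _ fun s => expNeg_le_one _)]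
        simp

end Marking

/-! ### Laplace transforms determine laws -/

section Laplace

open scoped unitInterval BoundedContinuousFunction

/-- A finite measure on a cube is determined by its moments. -/
theorem Measure.ext_of_moments_unitInterval {ι : Type*} [Fintype ι] {μ ν : Measure (ι → I)}
    [IsFiniteMeasure μ] [IsFiniteMeasure ν]
    (h : ∀ m : ι → ℕ, ∫ x, ∏ i, (x i : ℝ) ^ m i ∂μ = ∫ x, ∏ i, (x i : ℝ) ^ m i ∂ν) : μ = ν := by
  let X : ι → ((ι → I) →ᵇ ℝ) := fun i =>
    BoundedContinuousFunction.mkOfCompact ⟨fun x => (x i : ℝ), by fun_prop⟩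
  let A : StarSubalgebra ℝ ((ι → I) →ᵇ ℝ) := StarAlgebra.adjoin ℝ (Set.range X)
  have hX : ∀ i x, X i x = (x i : ℝ) := fun i x => rfl
  refine ext_of_forall_mem_subalgebra_integral_eq_of_polish (𝕜 := ℝ) (A := A) ?_ ?_
  · intro x y hxy
    obtain ⟨i, hi⟩ := Function.ne_iff.1 hxy
    refine ⟨X i, ⟨_, ⟨X i, StarAlgebra.subset_adjoin _ _ ⟨i, rfl⟩, rfl⟩, rfl⟩, ?_⟩
    exact fun h => hi (Subtype.ext h)
  · intro g hg
    have hg' : g ∈ Algebra.adjoin ℝ (Set.range X) := by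
      -- The coordinates are real, hence self-adjoint, so the star subalgebra they generate is the
      -- linear span of the monomials.
      have hstar : star (Set.range X) = Set.range X := by
        ext f
        simp only [Set.mem_star, Set.mem_range]
        constructor <;> rintro ⟨i, hi⟩ <;> refine ⟨i, ?_⟩
        · rw [← star_star f, ← hi]; ext x; simp
        · rw [← hi]; ext x; simp
      have := StarAlgebra.adjoin_toSubalgebra (R := ℝ) (Set.range X)
      rw [hstar, Set.union_self] at this
      rw [← this]
      exact hg
    have hspan : g ∈ Submodule.span ℝ (Submonoid.closure (Set.range X) : Set ((ι → I) →ᵇ ℝ)) := by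
      rw [← Algebra.adjoin_eq_span]
      exact hg'
    have hmon : ∀ f ∈ Submonoid.closure (Set.range X),
        ∃ m : ι → ℕ, ∀ x, f x = ∏ i, (x i : ℝ) ^ m i := by
      intro f hf
      induction hf using Submonoid.closure_induction with
      | mem f hf =>
        classical
        obtain ⟨i, rfl⟩ := hf
        refine ⟨Pi.single i 1, fun x => ?_⟩
        rw [Finset.prod_eq_single i]
        · simp [hX]
        · intro j _ hj
          simp [hj]
        · simp
      | one => exact ⟨0, fun x => by simp⟩
      | mul f g _ _ hf hg =>
        obtain ⟨m, hm⟩ := hf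
        obtain ⟨n, hn⟩ := hg
        refine ⟨m + n, fun x => ?_⟩
        simp [hm, hn, pow_add, Finset.prod_mul_distrib]
    clear hg hg'
    induction hspan using Submodule.span_induction with
    | mem f hf =>
      obtain ⟨m, hm⟩ := hmon f hf
      simpa only [hm] using h m
    | zero => simp
    | add f g _ _ hf hg =>
      simp only [BoundedContinuousFunction.coe_add, Pi.add_apply]
      rw [integral_add (f.integrable _) (g.integrable _), hf, hg,
        integral_add (f.integrable _) (g.integrable _)]
    | smul c f _ hf =>
      simp only [BoundedContinuousFunction.coe_smul, smul_eq_mul]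
      rw [integral_const_mul, integral_const_mul, hf]

/-- The map `n ↦ exp (-n)` from `ℕ∞` to the unit interval. -/
noncomputable def expNegUnitInterval (n : ℕ∞) : I :=
  ⟨(expNeg n).toReal, toReal_nonneg, by
    simpa using toReal_mono one_ne_top (expNeg_le_one n)⟩

lemma expNegUnitInterval_injective : Function.Injective expNegUnitInterval := by
  intro m n h
  have h' : (expNeg m).toReal = (expNeg n).toReal := congrArg (fun z : I => (z : ℝ)) h
  have := (toReal_eq_toReal_iff' (expNeg_ne_top _) (expNeg_ne_top _)).1 h'
  exact_mod_cast expNeg_injective this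

/-- The law of a vector with values in `ℕ∞` is determined by its Laplace transform. -/
theorem Measure.ext_of_lintegral_expNeg {ι : Type*} [Fintype ι] {μ ν : Measure (ι → ℕ∞)}
    [IsFiniteMeasure μ] [IsFiniteMeasure ν]
    (h : ∀ s : ι → ℕ, ∫⁻ y, expNeg (∑ i, s i * (y i : ℝ≥0∞)) ∂μ =
      ∫⁻ y, expNeg (∑ i, s i * (y i : ℝ≥0∞)) ∂ν) : μ = ν := by
  -- Under n ↦ exp(-n), with ∞ ↦ 0, the Laplace transform at integer arguments becomes the family of
  -- moments of a law on a cube.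
  let emb : (ι → ℕ∞) → (ι → I) := fun y i => expNegUnitInterval (y i)
  have hemb : Measurable emb :=
    measurable_pi_iff.2 fun i =>
      (Measurable.of_discrete (f := expNegUnitInterval)).comp (measurable_pi_apply i)
  have hembi : Function.Injective emb := fun y z hyz =>
    funext fun i => expNegUnitInterval_injective (congrFun hyz i)
  have hprod : ∀ (s : ι → ℕ) (y : ι → ℕ∞), ∏ i, (emb y i : ℝ) ^ s i =
      (expNeg (∑ i, s i * (y i : ℝ≥0∞))).toReal := by
    intro s y
    rw [expNeg_sum, toReal_prod]
    refine Finset.prod_congr rfl fun i _ => ?_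
    rw [mul_comm, expNeg_nsmul, toReal_pow]
    rfl
  have hint : ∀ (ρ : Measure (ι → ℕ∞)) (s : ι → ℕ),
      ∫ x, ∏ i, (x i : ℝ) ^ s i ∂(ρ.map emb) =
        (∫⁻ y, expNeg (∑ i, s i * (y i : ℝ≥0∞)) ∂ρ).toReal := by
    intro ρ s
    have hm : Measurable fun y : ι → ℕ∞ => expNeg (∑ i, s i * (y i : ℝ≥0∞)) :=
      measurable_expNeg.comp (Finset.measurable_sum _ fun i _ =>
        (Measurable.of_discrete (f := fun n : ℕ∞ => (s i : ℝ≥0∞) * (n : ℝ≥0∞))).comp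
          (measurable_pi_apply i))
    rw [integral_map hemb.aemeasurable (Continuous.aestronglyMeasurable (by fun_prop))]
    simp_rw [hprod]
    exact integral_toReal hm.aemeasurable (ae_of_all _ fun y => (expNeg_ne_top _).lt_top)
  have hmap : μ.map emb = ν.map emb :=
    Measure.ext_of_moments_unitInterval fun m => by rw [hint, hint, h]
  have hme : MeasurableEmbedding emb := hemb.measurableEmbedding hembi
  rw [← hme.comap_map μ, hmap, hme.comap_map]

/-- The law of a vector of independent Poisson random variables, seen as a law on `ℕ∞`-valued
vectors. -/
noncomputable def piPoisson {ι : Type*} [Fintype ι] (a : ι → ℝ≥0) : Measure (ι → ℕ∞) :=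
  Measure.pi fun i => (poissonMeasure (a i)).map (fun n : ℕ => (n : ℕ∞))

instance isProbabilityMeasure_map_poissonMeasure (a : ℝ≥0) :
    IsProbabilityMeasure ((poissonMeasure a).map (fun n : ℕ => (n : ℕ∞))) :=
  Measure.isProbabilityMeasure_map Measurable.of_discrete.aemeasurable

instance {ι : Type*} [Fintype ι] (a : ι → ℝ≥0) : IsProbabilityMeasure (piPoisson a) :=
  inferInstanceAs (IsProbabilityMeasure (Measure.pi _))

lemma lintegral_expNeg_piPoisson {ι : Type*} [Fintype ι] (a : ι → ℝ≥0) (s : ι → ℕ) :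
    ∫⁻ y, expNeg (∑ i, s i * (y i : ℝ≥0∞)) ∂(piPoisson a) =
      expNeg (∑ i, a i * (1 - expNeg (s i))) := by
  have hi := iIndepFun_pi
    (μ := fun i => (poissonMeasure (a i)).map (fun n : ℕ => (n : ℕ∞)))
    (X := fun i (n : ℕ∞) => expNeg (s i * (n : ℝ≥0∞)))
    (fun i => Measurable.of_discrete.aemeasurable)
  have h := lintegral_prod_eq_prod_lintegral_of_indepFun Finset.univ _ hi
    (fun i => (Measurable.of_discrete (f := fun n : ℕ∞ => expNeg (s i * (n : ℝ≥0∞)))).comp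
      (measurable_pi_apply i))
  simp_rw [expNeg_sum]
  refine h.trans (Finset.prod_congr rfl fun i _ => ?_)
  rw [← lintegral_expNeg_mul_map_poissonMeasure]
  exact (measurePreserving_eval
    (fun i => (poissonMeasure (a i)).map (fun n : ℕ => (n : ℕ∞))) i).lintegral_comp
    (f := fun n : ℕ∞ => expNeg (s i * (n : ℝ≥0∞))) .of_discrete

/-- A random vector with the Laplace transform of independent Poisson variables has their law. -/
theorem map_eq_piPoisson {Ω ι : Type*} [Fintype ι] [MeasurableSpace Ω] {P : Measure Ω}
    [IsProbabilityMeasure P] {Y : ι → Ω → ℕ∞} (hY : ∀ i, Measurable (Y i)) {a : ι → ℝ≥0}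
    (h : ∀ s : ι → ℕ, ∫⁻ ω, expNeg (∑ i, s i * (Y i ω : ℝ≥0∞)) ∂P =
      expNeg (∑ i, a i * (1 - expNeg (s i)))) :
    P.map (fun ω i => Y i ω) = piPoisson a := by
  have hY' : Measurable fun ω i => Y i ω := measurable_pi_iff.2 hY
  have := Measure.isProbabilityMeasure_map hY'.aemeasurable (μ := P)
  refine Measure.ext_of_lintegral_expNeg fun s => ?_
  have hm : Measurable fun y : ι → ℕ∞ => expNeg (∑ i, s i * (y i : ℝ≥0∞)) :=
    measurable_expNeg.comp (Finset.measurable_sum _ fun i _ =>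
      (Measurable.of_discrete (f := fun n : ℕ∞ => (s i : ℝ≥0∞) * (n : ℝ≥0∞))).comp
        (measurable_pi_apply i))
  rw [lintegral_map hm hY', h, lintegral_expNeg_piPoisson]

lemma piPoisson_singleton {ι : Type*} [Fintype ι] (a : ι → ℝ≥0) (y : ι → ℕ) :
    piPoisson a {fun i => (y i : ℕ∞)} =
      ENNReal.ofReal (∏ i, (Real.exp (-(a i)) * (a i : ℝ) ^ y i / (y i)!)) := by
  rw [piPoisson, Measure.pi_singleton, ENNReal.ofReal_prod_of_nonneg fun i _ => by positivity]
  refine Finset.prod_congr rfl fun i _ => ?_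
  rw [Measure.map_apply .of_discrete (.singleton _), ← poissonMeasure_singleton]
  congr 1
  ext n
  simp

end Laplace

/-! ### Time intervals occupied by a session -/

namespace Session

variable {N : ℕ}

lemma measurable_stageStart (j : Fin N) : Measurable fun s : Session N => s.stageStart j :=
  Finset.measurable_sum _ fun i _ => (measurable_pi_apply i).comp measurable_snd

lemma measurable_holdingTime (j : Fin N) : Measurable fun s : Session N => s.holdingTime j :=
  (measurable_fst.sub (measurable_stageStart j)).min ((measurable_pi_apply j).comp measurable_snd)

lemma measurableSet_reaches (j : Fin N) : MeasurableSet {s : Session N | s.Reaches j} :=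
  measurableSet_lt (measurable_stageStart j) measurable_fst

lemma measurableSet_inStage (j : Fin N) :
    MeasurableSet {p : ℝ × Session N | p.2.InStage j p.1} := by
  have h1 : Measurable fun p : ℝ × Session N => p.2.stageStart j :=
    (measurable_stageStart j).comp measurable_snd
  have h2 : Measurable fun p : ℝ × Session N => p.2.holdingTime j :=
    (measurable_holdingTime j).comp measurable_snd
  exact (measurable_snd (measurableSet_reaches j)).inter
    ((measurableSet_le h1 measurable_fst).inter (measurableSet_lt measurable_fst (h1.add h2)))

lemma holdingTime_pos {s : Session N} {j : Fin N} (hs : 0 < s.dwell j) (hj : s.Reaches j) :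
    0 < s.holdingTime j :=
  lt_min (sub_pos.2 hj) hs

lemma stageStart_add_dwell_le {s : Session N} (hs : ∀ j, 0 < s.dwell j) {i j : Fin N}
    (hij : i < j) : s.stageStart i + s.dwell i ≤ s.stageStart j := by
  have h : insert i (Finset.Iio i) ⊆ Finset.Iio j := by
    intro k hk
    rw [Finset.mem_insert, Finset.mem_Iio] at hk
    rw [Finset.mem_Iio]
    rcases hk with rfl | hk
    · exact hij
    · exact hk.trans hij
  have := Finset.sum_le_sum_of_subset_of_nonneg h (f := fun k => s.dwell k)
    fun k _ _ => (hs k).le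
  rw [Finset.sum_insert (by simp)] at this
  rw [add_comm]
  exact this

/-- A stage ends no later than its dwell time does, and positive dwell times order the intervals of
the stages. This exclusion is the source of independence between cells. -/
lemma InStage.unique {s : Session N} (hs : ∀ j, 0 < s.dwell j) {i j : Fin N} {u : ℝ}
    (hi : s.InStage i u) (hj : s.InStage j u) : i = j := by
  have key : ∀ {i j : Fin N}, s.InStage i u → s.InStage j u → ¬ i < j := by
    intro i j hi hj hij
    have h1 := stageStart_add_dwell_le hs hij
    have h2 : s.holdingTime i ≤ s.dwell i := min_le_right _ _
    linarith [hi.2.2, hj.2.1]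
  exact le_antisymm (not_lt.1 (key hj hi)) (not_lt.1 (key hi hj))

/-- The admissible starting times form a half-open interval; changing t only translates it, which
makes the mean numbers independent of time. -/
lemma volume_setOf_inStage (s : Session N) (j : Fin N) (t : ℝ) :
    volume {x | s.InStage j (t - x)} =
      {s : Session N | s.Reaches j}.indicator (fun s => ENNReal.ofReal (s.holdingTime j)) s := by
  by_cases h : s.Reaches j
  · have : {x | s.InStage j (t - x)} =
        Set.Ioc (t - s.stageStart j - s.holdingTime j) (t - s.stageStart j) := by
      ext x
      simp only [InStage, h, true_and, Set.mem_ofPred_eq, Set.mem_Ioc]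
      constructor <;> rintro ⟨h1, h2⟩ <;> constructor <;> linarith
    rw [this, Real.volume_Ioc, Set.indicator_of_mem (by exact h)]
    congr 1
    ring
  · simp [InStage, h]

end Session

/-! ### Mean numbers of users -/

namespace CellularNetwork

variable {C : ℕ} (M : CellularNetwork C)

/-- Sessions of a route and their starting times that put a user in stage `j` at time `t`. -/
def inStageSet (A : Set ℝ) (t : ℝ) (l : Fin M.L) (j : Fin (M.N l)) : Set (ℝ × Session (M.N l)) :=
  {p | p.1 ∈ A ∧ p.2.InStage j (t - p.1)}

variable {M} in
lemma measurableSet_inStageSet {A : Set ℝ} (hA : MeasurableSet A) (t : ℝ) (l : Fin M.L)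
    (j : Fin (M.N l)) : MeasurableSet (M.inStageSet A t l j) :=
  (measurable_fst hA).inter (((measurable_const.sub measurable_fst).prodMk measurable_snd)
    (Session.measurableSet_inStage j))

/-- Mean time that a session of route `l` spends in stage `j`, restricted to the starting times in
`A` that make it be there at time `t`. -/
noncomputable def stageMass (A : Set ℝ) (t : ℝ) (l : Fin M.L) (j : Fin (M.N l)) : ℝ≥0∞ :=
  ∫⁻ s, volume {x | (x, s) ∈ M.inStageSet A t l j} ∂(M.law l)

/-- Mean number of users in cell `n` at time `t` among the sessions that started in `A`. -/
noncomputable def meanUsers (A : Set ℝ) (t : ℝ) (n : Fin C) : ℝ≥0∞ :=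
  ∑ l, ∑ j, if M.cell l j = n then M.rate l * M.stageMass A t l j else 0

lemma lintegral_holdingTime_lt_top (l : Fin M.L) (j : Fin (M.N l)) :
    ∫⁻ s in {s : Session (M.N l) | s.Reaches j}, ENNReal.ofReal (s.holdingTime j) ∂(M.law l) < ∞ :=
  (M.integrable_holdingTime l j).lintegral_lt_top

lemma stageMass_univ (t : ℝ) (l : Fin M.L) (j : Fin (M.N l)) :
    M.stageMass Set.univ t l j = ∫⁻ s in {s : Session (M.N l) | s.Reaches j},
      ENNReal.ofReal (s.holdingTime j) ∂(M.law l) := by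
  rw [← lintegral_indicator (Session.measurableSet_reaches j)]
  refine lintegral_congr fun s => ?_
  rw [← s.volume_setOf_inStage j t]
  simp [inStageSet]

lemma stageMass_mono {A B : Set ℝ} (h : A ⊆ B) (t : ℝ) (l : Fin M.L) (j : Fin (M.N l)) :
    M.stageMass A t l j ≤ M.stageMass B t l j :=
  lintegral_mono fun _ => measure_mono fun _ hx => ⟨h hx.1, hx.2⟩

lemma stageMass_ne_top (A : Set ℝ) (t : ℝ) (l : Fin M.L) (j : Fin (M.N l)) :
    M.stageMass A t l j ≠ ∞ :=
  ne_top_of_le_ne_top (M.lintegral_holdingTime_lt_top l j).ne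
    ((M.stageMass_mono (Set.subset_univ A) t l j).trans_eq (M.stageMass_univ t l j))

lemma meanUsers_ne_top (A : Set ℝ) (t : ℝ) (n : Fin C) : M.meanUsers A t n ≠ ∞ := by
  refine ENNReal.sum_ne_top.2 fun l _ => ENNReal.sum_ne_top.2 fun j _ => ?_
  split_ifs
  · exact ENNReal.mul_ne_top coe_ne_top (M.stageMass_ne_top A t l j)
  · exact zero_ne_top

lemma tendsto_stageMass (l : Fin M.L) (j : Fin (M.N l)) :
    Tendsto (fun t => M.stageMass (Set.Ioi 0) t l j) atTop (𝓝 (M.stageMass Set.univ 0 l j)) := by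
  rw [stageMass_univ, ← lintegral_indicator (Session.measurableSet_reaches j)]
  refine tendsto_lintegral_filter_of_dominated_convergence
    ({s : Session (M.N l) | s.Reaches j}.indicator fun s => ENNReal.ofReal (s.holdingTime j))
    ?_ ?_ ?_ ?_
  · exact Eventually.of_forall fun t =>
      measurable_measure_prodMk_right (measurableSet_inStageSet measurableSet_Ioi t l j)
  · refine Eventually.of_forall fun t => ae_of_all _ fun s => ?_
    rw [← s.volume_setOf_inStage j t]
    exact measure_mono fun x hx => hx.2
  · rw [lintegral_indicator (Session.measurableSet_reaches j)]
    exact (M.lintegral_holdingTime_lt_top l j).ne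
  · refine ae_of_all _ fun s => tendsto_const_nhds.congr' ?_
    -- From this time on, every starting time that puts the session in stage j is already positive,
    -- so the restriction to (0, ∞) loses nothing.
    filter_upwards [eventually_ge_atTop (s.stageStart j + s.holdingTime j)] with t ht
    rw [← s.volume_setOf_inStage j t]
    congr 1
    ext x
    refine ⟨fun h => ⟨?_, h⟩, fun h => h.2⟩
    have := h.2.2
    simp only [Set.mem_Ioi]
    linarith

lemma tendsto_meanUsers (n : Fin C) :
    Tendsto (fun t => M.meanUsers (Set.Ioi 0) t n) atTop (𝓝 (M.meanUsers Set.univ 0 n)) := by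
  refine tendsto_finsetSum _ fun l _ => tendsto_finsetSum _ fun j _ => ?_
  split_ifs
  · exact ENNReal.Tendsto.const_mul (M.tendsto_stageMass l j) (.inr coe_ne_top)
  · exact tendsto_const_nhds

lemma arrivalRate_nonneg (n : Fin C) : 0 ≤ M.arrivalRate n :=
  Finset.sum_nonneg fun l _ => Finset.sum_nonneg fun j _ => by split_ifs <;> positivity

lemma ae_holdingTime_pos (l : Fin M.L) (j : Fin (M.N l)) :
    ∀ᵐ s ∂(M.law l).restrict {s : Session (M.N l) | s.Reaches j}, 0 < s.holdingTime j := by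
  rw [ae_restrict_iff' (Session.measurableSet_reaches j)]
  filter_upwards [M.law_pos l] with s hs hj
  exact Session.holdingTime_pos (hs.2 j) hj

/-- A stage is almost surely not reached if the arrival rate of its cell is zero. -/
lemma law_reaches_eq_zero {n : Fin C} (h : M.arrivalRate n = 0) {l : Fin M.L} {j : Fin (M.N l)}
    (hn : M.cell l j = n) : M.law l {s | s.Reaches j} = 0 := by
  have := M.law_prob l
  have hnn : ∀ (l : Fin M.L) (j : Fin (M.N l)), 0 ≤ if M.cell l j = n then
      (M.rate l : ℝ) * (M.law l).real {s | s.Reaches j} else 0 := fun l j => by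
    split_ifs <;> positivity
  have h1 := (Finset.sum_eq_zero_iff_of_nonneg
    (fun l _ => Finset.sum_nonneg fun j _ => hnn l j)).1 h l (Finset.mem_univ _)
  have h2 := (Finset.sum_eq_zero_iff_of_nonneg (fun j _ => hnn l j)).1 h1 j (Finset.mem_univ _)
  rw [if_pos hn, mul_eq_zero] at h2
  rcases h2 with h2 | h2
  · exact absurd h2 (by exact_mod_cast (M.rate_pos l).ne')
  · exact (measureReal_eq_zero_iff).1 h2

/-- The case to check is 0 / 0: at zero arrival rate the stages of the cell are almost surely not
reached, so the numerator vanishes as well. -/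
lemma arrivalRate_mul_meanHoldingTime (n : Fin C) :
    M.arrivalRate n * M.meanHoldingTime n = ∑ l, ∑ j, if M.cell l j = n then
      (M.rate l : ℝ) * ∫ s in {s : Session (M.N l) | s.Reaches j}, s.holdingTime j ∂(M.law l)
      else 0 := by
  rcases eq_or_ne (M.arrivalRate n) 0 with h | h
  · rw [h, zero_mul]
    refine (Finset.sum_eq_zero fun l _ => Finset.sum_eq_zero fun j _ => ?_).symm
    split_ifs with hn
    · rw [Measure.restrict_eq_zero.2 (M.law_reaches_eq_zero h hn)]
      simp
    · rfl
  · rw [meanHoldingTime, mul_div_cancel₀ _ h]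

lemma toReal_meanUsers_univ (t : ℝ) (n : Fin C) :
    (M.meanUsers Set.univ t n).toReal = M.arrivalRate n * M.meanHoldingTime n := by
  have hne : ∀ (l : Fin M.L) (j : Fin (M.N l)),
      (if M.cell l j = n then M.rate l * M.stageMass Set.univ t l j else 0) ≠ ∞ := fun l j => by
    split_ifs
    · exact ENNReal.mul_ne_top coe_ne_top (M.stageMass_ne_top _ t l j)
    · exact zero_ne_top
  rw [arrivalRate_mul_meanHoldingTime, meanUsers,
    ENNReal.toReal_sum fun l _ => ENNReal.sum_ne_top.2 fun j _ => hne l j]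
  refine Finset.sum_congr rfl fun l _ => ?_
  rw [ENNReal.toReal_sum fun j _ => hne l j]
  refine Finset.sum_congr rfl fun j _ => ?_
  split_ifs
  · rw [toReal_mul, coe_toReal, stageMass_univ, integral_eq_lintegral_of_nonneg_ae
      ((M.ae_holdingTime_pos l j).mono fun s hs => hs.le)
      (Session.measurable_holdingTime j).aestronglyMeasurable]
  · simp

lemma toNNReal_meanUsers_univ (t : ℝ) (n : Fin C) :
    (M.meanUsers Set.univ t n).toNNReal = (M.arrivalRate n * M.meanHoldingTime n).toNNReal := by
  rw [← M.toReal_meanUsers_univ t n, ENNReal.toNNReal_toReal_eq]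

lemma meanHoldingTime_nonneg (n : Fin C) : 0 ≤ M.meanHoldingTime n := by
  refine div_nonneg (Finset.sum_nonneg fun l _ => Finset.sum_nonneg fun j _ => ?_)
    (M.arrivalRate_nonneg n)
  split_ifs
  · exact mul_nonneg (by positivity)
      (integral_nonneg_of_ae ((M.ae_holdingTime_pos l j).mono fun s hs => hs.le))
  · rfl

/-- A zero mean would make almost surely positive holding times integrate to zero, so no stage of
the cell would be reached. Positivity is what allows a service rate 1 / `meanHoldingTime`. -/
lemma meanHoldingTime_pos {n : Fin C} (h : 0 < M.arrivalRate n) : 0 < M.meanHoldingTime n := by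
  refine (M.meanHoldingTime_nonneg n).lt_of_ne' fun h0 => h.ne' ?_
  have hsum := M.arrivalRate_mul_meanHoldingTime n
  rw [h0, mul_zero] at hsum
  have hnn : ∀ (l : Fin M.L) (j : Fin (M.N l)), 0 ≤ if M.cell l j = n then
      (M.rate l : ℝ) * ∫ s in {s : Session (M.N l) | s.Reaches j}, s.holdingTime j ∂(M.law l)
      else 0 := fun l j => by
    split_ifs
    · exact mul_nonneg (by positivity)
        (integral_nonneg_of_ae ((M.ae_holdingTime_pos l j).mono fun s hs => hs.le))
    · rfl
  refine Finset.sum_eq_zero fun l _ => Finset.sum_eq_zero fun j _ => ?_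
  split_ifs with hn
  · have h1 := (Finset.sum_eq_zero_iff_of_nonneg
      (fun l _ => Finset.sum_nonneg fun j _ => hnn l j)).1 hsum.symm l (Finset.mem_univ _)
    have h2 := (Finset.sum_eq_zero_iff_of_nonneg (fun j _ => hnn l j)).1 h1 j (Finset.mem_univ _)
    rw [if_pos hn, mul_eq_zero, or_iff_right (by exact_mod_cast (M.rate_pos l).ne'),
      integral_eq_zero_iff_of_nonneg_ae ((M.ae_holdingTime_pos l j).mono fun s hs => hs.le)
        (M.integrable_holdingTime l j)] at h2
    have h3 : ∀ᵐ s ∂(M.law l).restrict {s : Session (M.N l) | s.Reaches j}, False := by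
      filter_upwards [h2, M.ae_holdingTime_pos l j] with s hs hs'
      exact hs'.ne' hs
    have h4 := Measure.restrict_eq_zero.1 (ae_eq_bot.1 (eventually_false_iff_eq_bot.1 h3))
    rw [Measure.real, h4, toReal_zero, mul_zero]
  · rfl

end CellularNetwork

/-! ### Joint law of the numbers of users -/

namespace CellularNetwork

variable {C : ℕ} {M : CellularNetwork C} {Ω : Type*}
  {arr : Fin M.L → ℕ → Ω → ℝ} {ses : (l : Fin M.L) → ℕ → Ω → Session (M.N l)}

/-- The weighted number of users is a sum of contributions of the sessions of the routes. -/
lemma sum_mul_userCount (A : Set ℝ) (t : ℝ) (σ : Fin C → ℝ≥0∞) (ω : Ω) :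
    ∑ n, σ n * (M.userCount arr ses A t n ω : ℝ≥0∞) =
      ∑ l, ∑' k, ∑ j, (M.inStageSet A t l j).indicator (fun _ => σ (M.cell l j))
        (arr l k ω, ses l k ω) := by
  have h1 : ∀ n, (M.userCount arr ses A t n ω : ℝ≥0∞) = ∑ l, ∑ j, ∑' k,
      if M.cell l j = n then (M.inStageSet A t l j).indicator 1 (arr l k ω, ses l k ω) else 0 := by
    intro n
    rw [userCount, ← ENNReal.tsum_set_one, tsum_subtype _ (fun _ => (1 : ℝ≥0∞)),
      ENNReal.summable.tsum_prod' fun _ => ENNReal.summable, tsum_fintype, Fintype.sum_sigma]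
    refine Finset.sum_congr rfl fun l _ => Finset.sum_congr rfl fun j _ => tsum_congr fun k => ?_
    by_cases h : M.cell l j = n
    · rw [if_pos h]
      by_cases hD : (arr l k ω, ses l k ω) ∈ M.inStageSet A t l j
      · rw [Set.indicator_of_mem hD, Set.indicator_of_mem (by exact ⟨h, hD⟩)]
        rfl
      · rw [Set.indicator_of_notMem hD, Set.indicator_of_notMem fun h' => hD h'.2]
    · simp [Set.indicator, h]
  simp_rw [h1, Finset.mul_sum]
  rw [Finset.sum_comm]
  refine Finset.sum_congr rfl fun l _ => ?_
  rw [Finset.sum_comm, Summable.tsum_finsetSum (fun _ _ => ENNReal.summable)]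
  refine Finset.sum_congr rfl fun j _ => ?_
  rw [Finset.sum_eq_single (M.cell l j)]
  · rw [← ENNReal.tsum_mul_left]
    refine tsum_congr fun k => ?_
    simp [Set.indicator]
  · intro n _ hn
    simp [hn.symm]
  · simp

variable [MeasurableSpace Ω] {P : Measure Ω}

lemma IsTraffic.measurable_userCount (hM : M.IsTraffic P arr ses) {A : Set ℝ}
    (hA : MeasurableSet A) (t : ℝ) (n : Fin C) : Measurable (M.userCount arr ses A t n) := by
  refine measurable_encard_setOf fun p => ?_
  by_cases hp : M.cell p.1.1 p.1.2 = n
  · simp only [hp, true_and]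
    exact ((hM.poisson p.1.1).measurable p.2).prodMk (hM.measurable_ses p.1.1 p.2)
      (measurableSet_inStageSet hA t p.1.1 p.1.2)
  · simp [hp]

/-- The contribution of one route to the Laplace transform of the numbers of users. -/
lemma IsTraffic.lintegral_expNeg_route [IsProbabilityMeasure P] (hM : M.IsTraffic P arr ses)
    {A : Set ℝ} (hA : MeasurableSet A) (t : ℝ) (σ : Fin C → ℝ≥0∞) (l : Fin M.L) :
    ∫⁻ ω, expNeg (∑' k, ∑ j, (M.inStageSet A t l j).indicator (fun _ => σ (M.cell l j))
        (arr l k ω, ses l k ω)) ∂P =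
      expNeg (∑ j, M.rate l * M.stageMass A t l j * (1 - expNeg (σ (M.cell l j)))) := by
  have := M.law_prob l
  have hD := fun j => measurableSet_inStageSet hA t l j
  rw [(hM.poisson l).lintegral_expNeg_tsum_mark (hM.measurable_ses l) (hM.hasLaw_ses l)
    (hM.indep_ses l) (hM.indep_arr_ses l)
    (F := fun p => ∑ j, (M.inStageSet A t l j).indicator (fun _ => σ (M.cell l j)) p)
    (Finset.measurable_sum _ fun j _ => measurable_const.indicator (hD j))]
  -- For almost every session at most one stage contributes, so 1 - exp(-·) again passes through the
  -- sum.
  have h1 : ∀ x, ∫⁻ s, (1 - expNeg (∑ j, (M.inStageSet A t l j).indicator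
      (fun _ => σ (M.cell l j)) (x, s))) ∂(M.law l) = ∫⁻ s, ∑ j, (M.inStageSet A t l j).indicator
      (fun _ => 1 - expNeg (σ (M.cell l j))) (x, s) ∂(M.law l) := by
    intro x
    refine lintegral_congr_ae ?_
    filter_upwards [M.law_pos l] with s hs
    by_cases hx : ∃ j, (x, s) ∈ M.inStageSet A t l j
    · obtain ⟨j, hj⟩ := hx
      have hne : ∀ i, i ≠ j → (x, s) ∉ M.inStageSet A t l i := fun i hij hi =>
        hij (Session.InStage.unique hs.2 hi.2 hj.2)
      rw [Finset.sum_eq_single j (fun i _ hi => Set.indicator_of_notMem (hne i hi) _) (by simp),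
        Finset.sum_eq_single j (fun i _ hi => Set.indicator_of_notMem (hne i hi) _) (by simp),
        Set.indicator_of_mem hj, Set.indicator_of_mem hj]
    · push Not at hx
      simp [hx]
  simp_rw [h1]
  have hm : ∀ j, Measurable ((M.inStageSet A t l j).indicator
      (fun _ => 1 - expNeg (σ (M.cell l j)))) := fun j => measurable_const.indicator (hD j)
  -- Tonelli: integrating over the starting time first produces `stageMass`.
  have h2 : ∫⁻ x, ∫⁻ s, ∑ j, (M.inStageSet A t l j).indicator
      (fun _ => 1 - expNeg (σ (M.cell l j))) (x, s) ∂(M.law l) =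
      ∑ j, M.stageMass A t l j * (1 - expNeg (σ (M.cell l j))) := by
    rw [← lintegral_prod (fun p => ∑ j, (M.inStageSet A t l j).indicator
      (fun _ => 1 - expNeg (σ (M.cell l j))) p)
      (Finset.measurable_sum _ fun j _ => hm j).aemeasurable,
      lintegral_finsetSum _ (fun j _ => hm j)]
    refine Finset.sum_congr rfl fun j _ => ?_
    rw [lintegral_indicator_const (hD j), mul_comm, Measure.prod_apply_symm (hD j)]
    rfl
  rw [h2, Finset.mul_sum]
  simp_rw [mul_assoc]

/-- The numbers of users in the cells are independent Poisson random variables. -/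
theorem IsTraffic.map_userCount [IsProbabilityMeasure P] (hM : M.IsTraffic P arr ses)
    {A : Set ℝ} (hA : MeasurableSet A) (t : ℝ) :
    P.map (fun ω n => M.userCount arr ses A t n ω) =
      piPoisson fun n => (M.meanUsers A t n).toNNReal := by
  refine map_eq_piPoisson (fun n => hM.measurable_userCount hA t n) fun σ => ?_
  simp_rw [sum_mul_userCount, expNeg_sum]
  have hmeas : ∀ l, Measurable fun p : (ℕ → ℝ) × (ℕ → Session (M.N l)) =>
      expNeg (∑' k, ∑ j, (M.inStageSet A t l j).indicator (fun _ => (σ (M.cell l j) : ℝ≥0∞))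
        (p.1 k, p.2 k)) := fun l =>
    measurable_expNeg.comp (Measurable.tsum fun k => Finset.measurable_sum _ fun j _ =>
      (measurable_const.indicator (measurableSet_inStageSet hA t l j)).comp (by fun_prop))
  have hi := hM.indep_routes.comp (fun l (p : (ℕ → ℝ) × (ℕ → Session (M.N l))) =>
      expNeg (∑' k, ∑ j, (M.inStageSet A t l j).indicator (fun _ => (σ (M.cell l j) : ℝ≥0∞))
        (p.1 k, p.2 k))) hmeas
  refine (lintegral_prod_eq_prod_lintegral_of_indepFun Finset.univ _ hi fun l =>
    (hmeas l).comp ((measurable_pi_iff.2 (hM.poisson l).measurable).prodMk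
      (measurable_pi_iff.2 (hM.measurable_ses l)))).trans ?_
  simp only [Function.comp_apply]
  simp_rw [hM.lintegral_expNeg_route hA t (fun n => (σ n : ℝ≥0∞)), ← expNeg_sum]
  congr 1
  -- Superposition: the exponents of all stages are regrouped by cell.
  simp_rw [coe_toNNReal (M.meanUsers_ne_top A t _), meanUsers, Finset.sum_mul]
  rw [Finset.sum_comm]
  refine Finset.sum_congr rfl fun l _ => ?_
  rw [Finset.sum_comm]
  refine Finset.sum_congr rfl fun j _ => ?_
  simp [ite_mul]

theorem IsTraffic.map_userCount_univ [IsProbabilityMeasure P] (hM : M.IsTraffic P arr ses)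
    (t : ℝ) :
    P.map (fun ω n => M.userCount arr ses Set.univ t n ω) =
      piPoisson fun n => (M.arrivalRate n * M.meanHoldingTime n).toNNReal := by
  rw [hM.map_userCount .univ]
  simp_rw [toNNReal_meanUsers_univ]

lemma IsTraffic.measure_userCount_eq [IsProbabilityMeasure P] (hM : M.IsTraffic P arr ses)
    {A : Set ℝ} (hA : MeasurableSet A) (t : ℝ) (y : Fin C → ℕ) :
    P {ω | ∀ n, M.userCount arr ses A t n ω = (y n : ℕ∞)} =
      ENNReal.ofReal (∏ n, (Real.exp (-(M.meanUsers A t n).toReal) *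
        (M.meanUsers A t n).toReal ^ y n / (y n)!)) := by
  have h := piPoisson_singleton (fun n => (M.meanUsers A t n).toNNReal) y
  rw [← hM.map_userCount hA t, Measure.map_apply
    (measurable_pi_iff.2 fun n => hM.measurable_userCount hA t n) (.singleton _)] at h
  convert h using 2
  · ext ω
    simp [funext_iff]
  · rfl

theorem IsTraffic.tendsto_measure_userCount [IsProbabilityMeasure P] (hM : M.IsTraffic P arr ses)
    (y : Fin C → ℕ) :
    Tendsto (fun t : ℝ => P {ω | ∀ n, M.userCount arr ses (Set.Ioi 0) t n ω = (y n : ℕ∞)})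
      atTop (𝓝 (ENNReal.ofReal (M.productPoisson y))) := by
  simp_rw [hM.measure_userCount_eq measurableSet_Ioi]
  refine ENNReal.tendsto_ofReal (tendsto_finsetProd _ fun n _ => ?_)
  have h := (ENNReal.tendsto_toReal (M.meanUsers_ne_top Set.univ 0 n)).comp (M.tendsto_meanUsers n)
  rw [toReal_meanUsers_univ] at h
  exact (((Real.continuous_exp.tendsto _).comp h.neg).mul (h.pow _)).div_const _

theorem IsTraffic.iIndepFun_userCount [IsProbabilityMeasure P] (hM : M.IsTraffic P arr ses)
    (t : ℝ) : iIndepFun (fun n => M.userCount arr ses Set.univ t n) P ∧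
      ∀ n, HasLaw (M.userCount arr ses Set.univ t n)
        ((poissonMeasure (M.arrivalRate n * M.meanHoldingTime n).toNNReal).map
          (fun i : ℕ => (i : ℕ∞))) P := by
  have hm := fun n => hM.measurable_userCount MeasurableSet.univ t n
  have hlaw : ∀ n, HasLaw (M.userCount arr ses Set.univ t n)
      ((poissonMeasure (M.arrivalRate n * M.meanHoldingTime n).toNNReal).map
        (fun i : ℕ => (i : ℕ∞))) P := fun n => by
    refine ⟨(hm n).aemeasurable, ?_⟩
    have h := congrArg (Measure.map (Function.eval n)) (hM.map_userCount_univ t)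
    rw [Measure.map_map (measurable_pi_apply n) (measurable_pi_iff.2 hm), piPoisson,
      (measurePreserving_eval _ n).map_eq] at h
    exact h
  refine ⟨?_, hlaw⟩
  rw [iIndepFun_iff_map_fun_eq_pi_map fun n => (hm n).aemeasurable, hM.map_userCount_univ]
  simp_rw [fun n => (hlaw n).map_eq]
  rfl

end CellularNetwork

/-! ### Uniqueness of stationary measures -/

section GlobalBalance

variable {α : Type*} {q : α → α → ℝ≥0∞}

/-- Global balance equations for the rates `q`, with values in `[0, ∞]`. -/
def GlobalBalance (q : α → α → ℝ≥0∞) (p : α → ℝ≥0∞) : Prop :=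
  ∀ x, ∑' z, p z * q z x = p x * ∑' z, q x z

lemma GlobalBalance.const_mul {p : α → ℝ≥0∞} (hp : GlobalBalance q p) (c : ℝ≥0∞) :
    GlobalBalance q fun x => c * p x := fun x => by
  simp_rw [mul_assoc]
  rw [ENNReal.tsum_mul_left, hp x]

/-- Adding the flow of k back gives the balance of p; cancelling it requires this flow to be finite
at each state. -/
lemma GlobalBalance.tsub {p k : α → ℝ≥0∞} (hp : GlobalBalance q p) (hk : GlobalBalance q k)
    (hkp : ∀ x, k x ≤ p x) (hfin : ∀ x, k x * ∑' z, q x z ≠ ∞) :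
    GlobalBalance q fun x => p x - k x := by
  intro x
  have h : ∑' z, (p z - k z) * q z x + ∑' z, k z * q z x =
      (p x - k x) * ∑' z, q x z + k x * ∑' z, q x z := by
    rw [← ENNReal.tsum_add, ← add_mul, tsub_add_cancel_of_le (hkp x), ← hp x]
    refine tsum_congr fun z => ?_
    rw [← add_mul, tsub_add_cancel_of_le (hkp z)]
  rw [hk x] at h
  exact (ENNReal.add_left_inj (hfin x)).1 h

/-- A state of mass zero has no outflow, hence no inflow, so all its predecessors have mass zero. -/
lemma GlobalBalance.eq_zero {p : α → ℝ≥0∞} (hp : GlobalBalance q p) {x₀ : α} (h0 : p x₀ = 0)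
    {x : α} (hx : Relation.ReflTransGen (fun x z => q x z ≠ 0) x x₀) : p x = 0 := by
  induction hx using Relation.ReflTransGen.head_induction_on with
  | refl => exact h0
  | @head x z hxz _ ih =>
    have h := hp z
    rw [ih, zero_mul, ENNReal.tsum_eq_zero] at h
    exact (mul_eq_zero.1 (h x)).resolve_right hxz

/-- An excessive measure with finite total flow is stationary. -/
lemma globalBalance_of_le {k : α → ℝ≥0∞}
    (hk : ∀ x, ∑' z, k z * q z x ≤ k x * ∑' z, q x z)
    (hfin : ∑' x, k x * ∑' z, q x z ≠ ∞) : GlobalBalance q k := by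
  -- Total inflow equals total outflow after exchanging the sums; when finite, this excludes strict
  -- inequality at any state.
  have hsum : ∑' x, ∑' z, k z * q z x = ∑' x, k x * ∑' z, q x z := by
    rw [ENNReal.tsum_comm]
    simp_rw [ENNReal.tsum_mul_left]
  intro x
  by_contra hne
  exact (ENNReal.tsum_lt_tsum (hsum ▸ hfin) hk ((hk x).lt_of_ne hne)).ne hsum

/-- Uniqueness, up to a factor, of the stationary measures, when there is one with finite total
flow and some state of positive mass can be reached from all states. -/
theorem GlobalBalance.exists_eq_const_mul {p π : α → ℝ≥0∞} (hp : GlobalBalance q p)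
    (hπ : GlobalBalance q π) (hfin : ∑' x, π x * ∑' z, q x z ≠ ∞) {x₀ : α} (h0 : π x₀ ≠ 0)
    (hπ0 : π x₀ ≠ ∞) (hp0 : p x₀ ≠ ∞)
    (hreach : ∀ x, Relation.ReflTransGen (fun x z => q x z ≠ 0) x x₀) :
    ∃ c, ∀ x, p x = c * π x := by
  set c := p x₀ / π x₀ with hc
  have hctop : c ≠ ∞ := ENNReal.div_ne_top hp0 h0
  have hcx : c * π x₀ = p x₀ := ENNReal.div_mul_cancel h0 hπ0
  have hcπ := hπ.const_mul c
  have hcfin : ∑' x, c * π x * ∑' z, q x z ≠ ∞ := by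
    simp_rw [mul_assoc]
    rw [ENNReal.tsum_mul_left]
    exact ENNReal.mul_ne_top hctop hfin
  -- The constant c makes both measures agree at x₀. The minimum has finite flow because c π has, so
  -- nothing is required of the flow of p. The differences c π - k and then p - c π are stationary
  -- and vanish at x₀, hence everywhere.
  let k : α → ℝ≥0∞ := fun x => min (p x) (c * π x)
  have hkfin : ∑' x, k x * ∑' z, q x z ≠ ∞ :=
    ne_top_of_le_ne_top hcfin (ENNReal.tsum_le_tsum fun x => mul_le_mul_left (min_le_right _ _) _)
  have hk : GlobalBalance q k := by
    refine globalBalance_of_le (fun x => ?_) hkfin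
    rcases le_total (p x) (c * π x) with h | h
    · rw [show k x = p x from min_eq_left h, ← hp x]
      exact ENNReal.tsum_le_tsum fun z => mul_le_mul_left (min_le_left _ _) _
    · rw [show k x = c * π x from min_eq_right h, ← hcπ x]
      exact ENNReal.tsum_le_tsum fun z => mul_le_mul_left (min_le_right _ _) _
  have h1 := hcπ.tsub hk (fun x => min_le_right _ _) (ENNReal.ne_top_of_tsum_ne_top hkfin)
  have hle : ∀ x, c * π x ≤ p x := fun x => by
    have := h1.eq_zero (x₀ := x₀) (by simp [k, hcx]) (hreach x)
    exact (tsub_eq_zero_iff_le.1 this).trans (min_le_left _ _)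
  have h2 := hp.tsub hcπ hle (ENNReal.ne_top_of_tsum_ne_top hcfin)
  refine ⟨c, fun x => le_antisymm ?_ (hle x)⟩
  exact tsub_eq_zero_iff_le.1 (h2.eq_zero (x₀ := x₀) (by simp [hcx]) (hreach x))

end GlobalBalance

/-! ### Products of Poisson weights -/

section PoissonWeight

variable {C : ℕ}

/-- The product of Poisson weights with means `a`. -/
noncomputable def poissonWeight (a : Fin C → ℝ) (y : Fin C → ℕ) : ℝ :=
  ∏ n, (Real.exp (-(a n)) * a n ^ y n / (y n)!)

variable {a : Fin C → ℝ}

lemma poissonWeight_nonneg (ha : ∀ n, 0 ≤ a n) (y : Fin C → ℕ) : 0 ≤ poissonWeight a y :=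
  Finset.prod_nonneg fun n _ => by have := ha n; positivity

lemma poissonWeight_zero_pos : 0 < poissonWeight a 0 :=
  Finset.prod_pos fun n _ => by simp; positivity

lemma poissonWeight_add_single (y : Fin C → ℕ) (n : Fin C) :
    poissonWeight a (y + Pi.single n 1) * (y n + 1 : ℕ) = a n * poissonWeight a y := by
  have h : ∀ m ∈ Finset.univ.erase n, Real.exp (-(a m)) * a m ^ (y + Pi.single n 1 : Fin C → ℕ) m /
      ((y + Pi.single n 1 : Fin C → ℕ) m)! = Real.exp (-(a m)) * a m ^ y m / (y m)! := fun m hm => by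
    simp [Finset.ne_of_mem_erase hm]
  rw [poissonWeight, poissonWeight, ← Finset.mul_prod_erase _ _ (Finset.mem_univ n),
    ← Finset.mul_prod_erase _ (fun m => Real.exp (-(a m)) * a m ^ y m / (y m)!)
      (Finset.mem_univ n), Finset.prod_congr rfl h]
  have h1 : ((y n + 1 : ℕ) : ℝ) ≠ 0 := by positivity
  have h2 : (((y n)! : ℕ) : ℝ) ≠ 0 := by positivity
  simp only [Pi.add_apply, Pi.single_eq_same, Nat.factorial_succ, pow_succ, Nat.cast_mul]
  field_simp

lemma tsum_ofReal_poissonWeight (ha : ∀ n, 0 ≤ a n) :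
    ∑' y, ENNReal.ofReal (poissonWeight a y) = 1 := by
  have h1 : ∀ y, ENNReal.ofReal (poissonWeight a y) =
      Measure.pi (fun n => poissonMeasure (a n).toNNReal) {y} := fun y => by
    rw [Measure.pi_singleton, poissonWeight, ENNReal.ofReal_prod_of_nonneg fun n _ => by
      have := ha n; positivity]
    refine Finset.prod_congr rfl fun n _ => ?_
    rw [poissonMeasure_singleton, Real.coe_toNNReal _ (ha n)]
  simp_rw [h1]
  have h2 := lintegral_countable' (μ := Measure.pi (fun n => poissonMeasure (a n).toNNReal))
    fun _ : Fin C → ℕ => (1 : ℝ≥0∞)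
  simpa using h2.symm

lemma hasSum_poissonWeight (ha : ∀ n, 0 ≤ a n) : HasSum (poissonWeight a) 1 := by
  have h := tsum_ofReal_poissonWeight ha
  have hs : Summable (poissonWeight a) := by
    have := ENNReal.summable_toReal (f := fun y => ENNReal.ofReal (poissonWeight a y))
      (by rw [h]; exact one_ne_top)
    simpa [ENNReal.toReal_ofReal (poissonWeight_nonneg ha _)] using this
  rw [← ENNReal.ofReal_tsum_of_nonneg (poissonWeight_nonneg ha) hs, ENNReal.ofReal_eq_one] at h
  exact h ▸ hs.hasSum

lemma tsum_poissonWeight_mul_apply (ha : ∀ n, 0 ≤ a n) (n : Fin C) :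
    ∑' y, ENNReal.ofReal (poissonWeight a y) * (y n : ℝ≥0∞) = ENNReal.ofReal (a n) := by
  have hinj : Function.Injective fun y : Fin C → ℕ => y + Pi.single n 1 :=
    add_left_injective _
  -- Only states with a customer at n contribute, so the sum is reindexed by removing that customer.
  rw [← hinj.tsum_eq]
  · have : ∀ y : Fin C → ℕ, ENNReal.ofReal (poissonWeight a (y + Pi.single n 1)) *
        ((y + Pi.single n 1 : Fin C → ℕ) n : ℕ) = ENNReal.ofReal (a n) * ENNReal.ofReal (poissonWeight a y) :=
      fun y => by
        rw [← ENNReal.ofReal_mul (ha n), ← poissonWeight_add_single,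
          ENNReal.ofReal_mul (poissonWeight_nonneg ha _), ENNReal.ofReal_natCast]
        simp
    simp_rw [this]
    rw [ENNReal.tsum_mul_left, tsum_ofReal_poissonWeight ha, mul_one]
  · intro y hy
    have hy' : y n ≠ 0 := fun h => hy (by simp [h])
    refine ⟨y - Pi.single n 1, ?_⟩
    ext m
    rcases eq_or_ne m n with rfl | hm
    · simp; omega
    · simp [hm]

end PoissonWeight

/-! ### Adding and removing one customer -/

section Single

variable {C : ℕ}

lemma eq_add_single_iff {x z : Fin C → ℕ} {n : Fin C} :
    x = z + Pi.single n 1 ↔ 1 ≤ x n ∧ z = x - Pi.single n 1 := by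
  constructor
  · rintro rfl
    simp
  · rintro ⟨h, rfl⟩
    ext m
    rcases eq_or_ne m n with rfl | hm
    · simp; omega
    · simp [hm]

lemma hasSum_ite_eq_add_single (x : Fin C → ℕ) (n : Fin C) (f : (Fin C → ℕ) → ℝ) :
    HasSum (fun z => if x = z + Pi.single n 1 then f z else 0)
      (if 1 ≤ x n then f (x - Pi.single n 1) else 0) := by
  have h := hasSum_single (f := fun z => if x = z + Pi.single n 1 then f z else 0)
    (x - Pi.single n 1) fun z hz => if_neg fun h => hz (eq_add_single_iff.1 h).2
  convert h using 1
  exact if_congr (by rw [eq_add_single_iff, and_iff_left rfl]) rfl rfl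

lemma hasSum_ite_add_single_eq (x : Fin C → ℕ) (n : Fin C) (f : (Fin C → ℕ) → ℝ) :
    HasSum (fun z => if z + Pi.single n 1 = x then f z else 0)
      (if 1 ≤ x n then f (x - Pi.single n 1) else 0) := by
  simp_rw [eq_comm (b := x)]
  exact hasSum_ite_eq_add_single x n f

end Single

/-! ### Stationary distribution of Jackson networks -/

namespace OpenJacksonNetwork

variable {C : ℕ} (J : OpenJacksonNetwork C)

lemma leave_nonneg (n : Fin C) : 0 ≤ 1 - ∑ m, J.route n m := sub_nonneg.2 (J.route_sum_le n)

lemma ext_term_nonneg (x y : Fin C → ℕ) (n : Fin C) :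
    0 ≤ if y = x + Pi.single n 1 then J.ext n else 0 := by
  split_ifs
  exacts [J.ext_nonneg n, le_rfl]

lemma leave_term_nonneg (x y : Fin C → ℕ) (n : Fin C) :
    0 ≤ if y + Pi.single n 1 = x then
      J.serviceRate n * x n * (1 - ∑ m, J.route n m) else 0 := by
  split_ifs
  · have := (J.serviceRate_pos n).le
    have := J.leave_nonneg n
    positivity
  · exact le_rfl

lemma route_term_nonneg (x y : Fin C → ℕ) (n m : Fin C) :
    0 ≤ if y + Pi.single n 1 = x + Pi.single m 1 then
      J.serviceRate n * x n * J.route n m else 0 := by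
  split_ifs
  · have := (J.serviceRate_pos n).le
    have := J.route_nonneg n m
    positivity
  · exact le_rfl

lemma transitionRate_nonneg (x y : Fin C → ℕ) : 0 ≤ J.transitionRate x y :=
  add_nonneg (add_nonneg (Finset.sum_nonneg fun n _ => J.ext_term_nonneg x y n)
    (Finset.sum_nonneg fun n _ => J.leave_term_nonneg x y n))
    (Finset.sum_nonneg fun n _ => Finset.sum_nonneg fun m _ => J.route_term_nonneg x y n m)

lemma transitionRate_leave_pos (w : Fin C → ℕ) {n : Fin C} (h : ∑ m, J.route n m < 1) :
    0 < J.transitionRate (w + Pi.single n 1) w := by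
  refine add_pos_of_pos_of_nonneg (add_pos_of_nonneg_of_pos
    (Finset.sum_nonneg fun n _ => J.ext_term_nonneg _ w n) ?_)
    (Finset.sum_nonneg fun n _ => Finset.sum_nonneg fun m _ => J.route_term_nonneg _ w n m)
  refine Finset.sum_pos' (fun n _ => J.leave_term_nonneg _ w n) ⟨n, Finset.mem_univ _, ?_⟩
  rw [if_pos rfl]
  have := J.serviceRate_pos n
  have := sub_pos.2 h
  simp only [Pi.add_apply, Pi.single_eq_same]
  positivity

lemma transitionRate_route_pos (w : Fin C → ℕ) {n m : Fin C} (h : 0 < J.route n m) :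
    0 < J.transitionRate (w + Pi.single n 1) (w + Pi.single m 1) := by
  refine add_pos_of_nonneg_of_pos (add_nonneg
    (Finset.sum_nonneg fun n _ => J.ext_term_nonneg _ _ n)
    (Finset.sum_nonneg fun n _ => J.leave_term_nonneg _ _ n)) ?_
  refine Finset.sum_pos' (fun n _ => Finset.sum_nonneg fun m _ => J.route_term_nonneg _ _ n m)
    ⟨n, Finset.mem_univ _, Finset.sum_pos' (fun m _ => J.route_term_nonneg _ _ n m)
      ⟨m, Finset.mem_univ _, ?_⟩⟩
  rw [if_pos (add_right_comm _ _ _)]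
  have := J.serviceRate_pos n
  simp only [Pi.add_apply, Pi.single_eq_same]
  positivity

/-- `y` can be reached from `x`. -/
def Reaches (x y : Fin C → ℕ) : Prop :=
  Relation.ReflTransGen (fun x z => 0 < J.transitionRate x z) x y

/-- If a customer cannot leave n directly, row n sums to 1, so the (k + 1)-step survival probability
averages the k-step ones. Some successor i of positive routing probability then has k-step survival
below 1, and the customer moves there. The case k = 0 is void: rows of the identity sum to 1. -/
lemma reaches_remove {k : ℕ} {n : Fin C} (hk : ∑ m, (J.route ^ k) n m < 1) (w : Fin C → ℕ) :
    J.Reaches (w + Pi.single n 1) w := by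
  induction k generalizing n with
  | zero => simp [Matrix.one_apply] at hk
  | succ k ih =>
    rcases (J.route_sum_le n).lt_or_eq with h | h
    · exact Relation.ReflTransGen.single (J.transitionRate_leave_pos w h)
    · have hsum : ∑ m, (J.route ^ (k + 1)) n m =
          ∑ i, J.route n i * ∑ m, (J.route ^ k) i m := by
        simp_rw [pow_succ', Matrix.mul_apply, Finset.mul_sum]
        exact Finset.sum_comm
      rw [hsum, ← h] at hk
      obtain ⟨i, -, hi⟩ := Finset.exists_lt_of_sum_lt hk
      have hpos : 0 < J.route n i := (J.route_nonneg n i).lt_of_ne' fun h0 => by simp [h0] at hi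
      exact Relation.ReflTransGen.head (J.transitionRate_route_pos w hpos)
        (ih (lt_of_mul_lt_mul_left (by simpa using hi) hpos.le))

lemma reaches_zero (x : Fin C → ℕ) : J.Reaches x 0 := by
  induction hs : ∑ n, x n generalizing x with
  | zero =>
    have : x = 0 := funext fun n => (Finset.sum_eq_zero_iff.1 hs) n (Finset.mem_univ n)
    rw [this]
    exact Relation.ReflTransGen.refl
  | succ s ih =>
    obtain ⟨n, -, hn⟩ := Finset.exists_ne_zero_of_sum_ne_zero (hs.trans_ne s.succ_ne_zero)
    have hx := eq_add_single_iff.2 ⟨Nat.one_le_iff_ne_zero.2 hn, rfl⟩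
    obtain ⟨k, hk⟩ := J.isOpen n
    have h1 := J.reaches_remove hk (x - Pi.single n 1)
    rw [← hx] at h1
    refine h1.trans (ih _ ?_)
    have h2 : ∑ m, x m = ∑ m, (x - Pi.single n 1 : Fin C → ℕ) m + ∑ m, (Pi.single n 1 : Fin C → ℕ) m := by
      rw [← Finset.sum_add_distrib]
      exact Finset.sum_congr rfl fun m _ => congrFun hx m
    rw [hs, Finset.sum_pi_single', if_pos (Finset.mem_univ n)] at h2
    omega

/-- Total transition rate out of the state `x`, including the customers fed back. -/
def outRate (x : Fin C → ℕ) : ℝ := ∑ n, J.ext n + ∑ n, J.serviceRate n * x n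

lemma hasSum_transitionRate (x : Fin C → ℕ) : HasSum (J.transitionRate x) (J.outRate x) := by
  have h1 := hasSum_sum fun (n : Fin C) (_ : n ∈ Finset.univ) =>
    hasSum_ite_eq (x + Pi.single n 1) (J.ext n)
  have h2 := hasSum_sum fun (n : Fin C) (_ : n ∈ Finset.univ) =>
    hasSum_ite_add_single_eq x n fun _ => J.serviceRate n * x n * (1 - ∑ m, J.route n m)
  have h3 := hasSum_sum fun (n : Fin C) (_ : n ∈ Finset.univ) =>
    hasSum_sum fun (m : Fin C) (_ : m ∈ Finset.univ) =>
      hasSum_ite_add_single_eq (x + Pi.single m 1) n fun _ =>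
        J.serviceRate n * x n * J.route n m
  -- The guards are redundant: where they fail, the factor `x n` is zero.
  have h4 : ∀ n, (if 1 ≤ x n then J.serviceRate n * x n * (1 - ∑ m, J.route n m) else 0) =
      J.serviceRate n * x n * (1 - ∑ m, J.route n m) := fun n => by
    split_ifs with h
    · rfl
    · simp [show x n = 0 by omega]
  have h5 : ∀ n m, (if 1 ≤ (x + Pi.single m 1 : Fin C → ℕ) n then
      J.serviceRate n * x n * J.route n m else 0) = J.serviceRate n * x n * J.route n m :=
    fun n m => by
      split_ifs with h
      · rfl
      · simp only [Pi.add_apply] at h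
        simp [show x n = 0 by omega]
  have h := (h1.add h2).add h3
  simp_rw [h4, h5] at h
  have h6 : ∑ n, J.ext n + ∑ n, J.serviceRate n * x n * (1 - ∑ m, J.route n m) +
      ∑ n, ∑ m, J.serviceRate n * x n * J.route n m = J.outRate x := by
    rw [outRate, add_assoc, ← Finset.sum_add_distrib]
    congr 1
    refine Finset.sum_congr rfl fun n _ => ?_
    rw [← Finset.mul_sum]
    ring
  rw [h6] at h
  exact h

/-- The flow into `x` under the weights `p`. -/
lemma hasSum_mul_transitionRate (p : (Fin C → ℕ) → ℝ) (x : Fin C → ℕ) :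
    HasSum (fun z => p z * J.transitionRate z x)
      ((∑ n, if 1 ≤ x n then p (x - Pi.single n 1) * J.ext n else 0) +
        (∑ n, p (x + Pi.single n 1) * (J.serviceRate n *
          ((x + Pi.single n 1 : Fin C → ℕ) n : ℕ) * (1 - ∑ m, J.route n m))) +
        ∑ n, ∑ m, if 1 ≤ (x + Pi.single n 1 : Fin C → ℕ) m then
          p (x + Pi.single n 1 - Pi.single m 1) * (J.serviceRate n *
            ((x + Pi.single n 1 - Pi.single m 1 : Fin C → ℕ) n : ℕ) * J.route n m) else 0) := by
  have h1 := hasSum_sum fun (n : Fin C) (_ : n ∈ Finset.univ) =>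
    hasSum_ite_eq_add_single x n fun z => p z * J.ext n
  have h2 := hasSum_sum fun (n : Fin C) (_ : n ∈ Finset.univ) =>
    hasSum_single (f := fun z : Fin C → ℕ => if x + Pi.single n 1 = z then
      p z * (J.serviceRate n * z n * (1 - ∑ m, J.route n m)) else 0)
      (x + Pi.single n 1) fun z hz => if_neg hz.symm
  have h3 := hasSum_sum fun (n : Fin C) (_ : n ∈ Finset.univ) =>
    hasSum_sum fun (m : Fin C) (_ : m ∈ Finset.univ) =>
      hasSum_ite_eq_add_single (x + Pi.single n 1) m fun z =>
        p z * (J.serviceRate n * z n * J.route n m)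
  have h := (h1.add h2).add h3
  simp only [if_true] at h
  convert h using 2 with z
  simp only [transitionRate, mul_add, Finset.mul_sum, mul_ite, mul_zero]

section Stationary

variable {J} {lam tbar : Fin C → ℝ}

/-- `Matches` fixes the service rate only at visited queues; at the others both sides vanish. -/
lemma Matches.serviceRate_mul (hJ : J.Matches lam tbar) (hlam : ∀ n, 0 ≤ lam n) (n : Fin C) :
    J.serviceRate n * (lam n * tbar n) = lam n := by
  rcases (hlam n).eq_or_lt with h | h
  · rw [← h]
    simp
  · rw [← hJ.2 n h]
    have := (J.serviceRate_pos n).ne'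
    field_simp

/-- The product of Poisson weights satisfies the global balance equations. -/
lemma Matches.hasSum_flow (hJ : J.Matches lam tbar) (hlam : ∀ n, 0 ≤ lam n) (x : Fin C → ℕ) :
    HasSum (fun z => poissonWeight (fun n => lam n * tbar n) z * J.transitionRate z x)
      (poissonWeight (fun n => lam n * tbar n) x * J.outRate x) := by
  set π := poissonWeight fun n => lam n * tbar n with hπ
  -- Flow of departures from n that leave w behind: it is as if customers arrived at n at rate `lam
  -- n` in state w.
  have key : ∀ (w : Fin C → ℕ) n, π (w + Pi.single n 1) *
      (J.serviceRate n * ((w + Pi.single n 1 : Fin C → ℕ) n : ℕ)) = lam n * π w := by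
    intro w n
    have h := poissonWeight_add_single (a := fun n => lam n * tbar n) w n
    rw [← hπ] at h
    rw [← hJ.serviceRate_mul hlam n, mul_assoc, ← h]
    simp only [Pi.add_apply, Pi.single_eq_same]
    ring
  let g : Fin C → ℝ := fun m => if 1 ≤ x m then π (x - Pi.single m 1) else 0
  have hg : ∀ m, lam m * g m = π x * (J.serviceRate m * x m) := by
    intro m
    by_cases h : 1 ≤ x m
    · have hx := eq_add_single_iff.2 ⟨h, rfl⟩
      have := key (x - Pi.single m 1) m
      rw [← hx] at this
      simp [g, h, this]
    · simp [g, show x m = 0 by omega]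
  have h1 : ∀ n, (if 1 ≤ x n then π (x - Pi.single n 1) * J.ext n else 0) = g n * J.ext n :=
    fun n => by simp [g, ite_mul]
  have h3 : ∀ n m, (if 1 ≤ (x + Pi.single n 1 : Fin C → ℕ) m then
      π (x + Pi.single n 1 - Pi.single m 1) * (J.serviceRate n *
        ((x + Pi.single n 1 - Pi.single m 1 : Fin C → ℕ) n : ℕ) * J.route n m) else 0) =
      g m * (lam n * J.route n m) := by
    intro n m
    by_cases h : 1 ≤ x m
    · have hx : x + Pi.single n 1 - Pi.single m 1 = x - Pi.single m 1 + Pi.single n 1 := by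
        have := eq_add_single_iff.2 ⟨h, rfl⟩
        nth_rewrite 1 [this]
        rw [add_right_comm, add_tsub_cancel_right]
      rw [if_pos (by simp only [Pi.add_apply]; omega), hx, ← mul_assoc, key]
      simp only [g, if_pos h]
      ring
    · simp only [g, if_neg h, zero_mul]
      -- With queue m empty in x, only feedback from m to itself passes the guard, and it carries
      -- the factor `x m` = 0.
      rcases eq_or_ne m n with rfl | hmn
      · simp [show x m = 0 by omega]
      · rw [if_neg]
        simpa [hmn] using h
  have h := J.hasSum_mul_transitionRate π x
  have h2 : ∀ n, π (x + Pi.single n 1) * (J.serviceRate n *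
      ((x + Pi.single n 1 : Fin C → ℕ) n : ℕ) * (1 - ∑ m, J.route n m)) =
      π x * (lam n - ∑ m, lam n * J.route n m) := fun n => by
    rw [← mul_assoc, key, ← Finset.mul_sum]
    ring
  simp_rw [h1, h2, h3] at h
  convert h using 1
  -- The traffic equations enter here. Summed over the queues, they say that customers leave the
  -- network at the total external arrival rate (`e2`).
  have hroute : ∀ m, ∑ n, lam n * J.route n m = lam m - J.ext m := fun m => by
    rw [hJ.1 m]
    ring
  have e1 : ∑ n, ∑ m, g m * (lam n * J.route n m) = ∑ m, g m * (lam m - J.ext m) := by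
    rw [Finset.sum_comm]
    simp_rw [← Finset.mul_sum, hroute]
  have e2 : ∑ n, (lam n - ∑ m, lam n * J.route n m) = ∑ n, J.ext n := by
    rw [Finset.sum_sub_distrib, Finset.sum_comm]
    simp_rw [hroute, Finset.sum_sub_distrib]
    ring
  have e3 : ∑ m, g m * (lam m - J.ext m) + ∑ n, g n * J.ext n =
      π x * ∑ n, J.serviceRate n * x n := by
    rw [← Finset.sum_add_distrib, Finset.mul_sum]
    exact Finset.sum_congr rfl fun n _ => by rw [← hg]; ring
  rw [e1, ← Finset.mul_sum, e2, outRate, mul_add, ← e3]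
  ring

lemma Matches.mean_nonneg (hJ : J.Matches lam tbar) (hlam : ∀ n, 0 ≤ lam n) (n : Fin C) :
    0 ≤ lam n * tbar n := by
  rcases (hlam n).eq_or_lt with h | h
  · rw [← h, zero_mul]
  · rw [← hJ.2 n h]
    have := J.serviceRate_pos n
    positivity

variable (J) in
lemma tsum_ofReal_transitionRate (x : Fin C → ℕ) :
    ∑' z, ENNReal.ofReal (J.transitionRate x z) = ENNReal.ofReal (J.outRate x) := by
  have h := J.hasSum_transitionRate x
  rw [← h.tsum_eq, ENNReal.ofReal_tsum_of_nonneg (J.transitionRate_nonneg x) h.summable]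

variable (J) in
-- The transfer to [0, ∞] needs summability of the inflow and outflow, since a real `tsum` that
-- diverges is 0 by convention.
lemma globalBalance_ofReal {p : (Fin C → ℕ) → ℝ} (hp : ∀ x, 0 ≤ p x)
    (h : ∀ x, ∑' z, p z * J.transitionRate z x = p x * ∑' z, J.transitionRate x z) :
    GlobalBalance (fun x z => ENNReal.ofReal (J.transitionRate x z))
      fun x => ENNReal.ofReal (p x) := by
  intro x
  simp_rw [← ENNReal.ofReal_mul (hp _)]
  rw [← ENNReal.ofReal_tsum_of_nonneg (fun z => mul_nonneg (hp z) (J.transitionRate_nonneg z x))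
    (J.hasSum_mul_transitionRate p x).summable, h, ENNReal.ofReal_mul (hp x),
    (J.hasSum_transitionRate x).tsum_eq, J.tsum_ofReal_transitionRate]

lemma Matches.isStationary (hJ : J.Matches lam tbar) (hlam : ∀ n, 0 ≤ lam n) :
    J.IsStationary (poissonWeight fun n => lam n * tbar n) :=
  ⟨poissonWeight_nonneg (hJ.mean_nonneg hlam), hasSum_poissonWeight (hJ.mean_nonneg hlam),
    fun x => by rw [(hJ.hasSum_flow hlam x).tsum_eq, (J.hasSum_transitionRate x).tsum_eq]⟩

/-- The outflow rate is affine in the numbers of customers, and these have finite Poisson means. -/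
lemma Matches.tsum_flow_ne_top (hJ : J.Matches lam tbar) (hlam : ∀ n, 0 ≤ lam n) :
    ∑' x, ENNReal.ofReal (poissonWeight (fun n => lam n * tbar n) x) *
      ∑' z, ENNReal.ofReal (J.transitionRate x z) ≠ ∞ := by
  have hμ : ∀ n, 0 ≤ J.serviceRate n := fun n => (J.serviceRate_pos n).le
  have hout : ∀ x, ENNReal.ofReal (J.outRate x) = ENNReal.ofReal (∑ n, J.ext n) +
      ∑ n, ENNReal.ofReal (J.serviceRate n) * (x n : ℝ≥0∞) := fun x => by
    rw [outRate, ENNReal.ofReal_add (Finset.sum_nonneg fun n _ => J.ext_nonneg n)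
      (Finset.sum_nonneg fun n _ => mul_nonneg (hμ n) (Nat.cast_nonneg _)),
      ENNReal.ofReal_sum_of_nonneg fun n _ => mul_nonneg (hμ n) (Nat.cast_nonneg _)]
    simp_rw [ENNReal.ofReal_mul (hμ _), ENNReal.ofReal_natCast]
  simp_rw [J.tsum_ofReal_transitionRate, hout, mul_add, Finset.mul_sum]
  rw [ENNReal.tsum_add, ENNReal.tsum_mul_right, Summable.tsum_finsetSum
    fun _ _ => ENNReal.summable, tsum_ofReal_poissonWeight (hJ.mean_nonneg hlam)]
  simp_rw [mul_left_comm, ENNReal.tsum_mul_left,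
    tsum_poissonWeight_mul_apply (hJ.mean_nonneg hlam)]
  refine ENNReal.add_ne_top.2 ⟨by simp, ENNReal.sum_ne_top.2 fun n _ => ?_⟩
  exact ENNReal.mul_ne_top ofReal_ne_top ofReal_ne_top

/-- The product of Poisson weights is the only stationary distribution. -/
theorem Matches.isStationary_iff (hJ : J.Matches lam tbar) (hlam : ∀ n, 0 ≤ lam n)
    (p : (Fin C → ℕ) → ℝ) :
    J.IsStationary p ↔ p = poissonWeight fun n => lam n * tbar n := by
  refine ⟨fun hp => ?_, fun hp => hp ▸ hJ.isStationary hlam⟩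
  have hπ := hJ.isStationary hlam
  set π := poissonWeight fun n => lam n * tbar n with hπdef
  obtain ⟨c, hc⟩ := (J.globalBalance_ofReal hp.1 hp.2.2).exists_eq_const_mul
    (J.globalBalance_ofReal hπ.1 hπ.2.2) (hJ.tsum_flow_ne_top hlam) (x₀ := 0)
    (ENNReal.ofReal_pos.2 poissonWeight_zero_pos).ne' ofReal_ne_top ofReal_ne_top
    fun x => Relation.ReflTransGen.mono (fun _ _ h => (ENNReal.ofReal_pos.2 h).ne') _ _
      (J.reaches_zero x)
  have hsum : ∀ r : (Fin C → ℕ) → ℝ, J.IsStationary r → ∑' x, ENNReal.ofReal (r x) = 1 :=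
    fun r hr => by
      rw [← ENNReal.ofReal_tsum_of_nonneg hr.1 hr.2.1.summable, hr.2.1.tsum_eq, ofReal_one]
  have h1 := hsum p hp
  simp_rw [hc] at h1
  rw [ENNReal.tsum_mul_left, hsum π hπ, mul_one] at h1
  funext x
  have := hc x
  rwa [h1, one_mul, ENNReal.ofReal_eq_ofReal_iff (hp.1 x) (hπ.1 x)] at this

end Stationary

/-- The network without routing between the queues. -/
noncomputable def isolated (lam tbar : Fin C → ℝ) (hlam : ∀ n, 0 ≤ lam n)
    (ht : ∀ n, 0 < lam n → 0 < tbar n) : OpenJacksonNetwork C where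
  ext := lam
  route := 0
  -- At an unvisited queue any positive rate would do; 1 / `tbar n` need not be positive there.
  serviceRate n := if 0 < lam n then 1 / tbar n else 1
  ext_nonneg := hlam
  route_nonneg _ _ := le_rfl
  route_sum_le _ := by simp
  serviceRate_pos n := by
    split_ifs with h
    · exact one_div_pos.2 (ht n h)
    · exact one_pos
  isOpen _ := ⟨1, by simp⟩

lemma matches_isolated (lam tbar : Fin C → ℝ) (hlam : ∀ n, 0 ≤ lam n)
    (ht : ∀ n, 0 < lam n → 0 < tbar n) : (isolated lam tbar hlam ht).Matches lam tbar :=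
  ⟨fun n => by simp [isolated], fun n hn => by simp [isolated, hn]⟩

end OpenJacksonNetwork

/-! ### The main theorem -/

theorem mainTheorem3 {C : ℕ} (M : CellularNetwork C)
    {Ω : Type*} [MeasurableSpace Ω] (P : Measure Ω) [IsProbabilityMeasure P]
    (arr : Fin M.L → ℕ → Ω → ℝ) (ses : (l : Fin M.L) → ℕ → Ω → Session (M.N l))
    (hM : M.IsTraffic P arr ses) :
    -- stationary regime: the joint distribution at every time is the product of Poisson laws
    (∀ (t : ℝ) (y : Fin C → ℕ),
      P {ω | ∀ n, M.userCount arr ses Set.univ t n ω = (y n : ℕ∞)} =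
        ENNReal.ofReal (M.productPoisson y)) ∧
    -- the numbers of users in the cells are independent Poisson random variables
    (∀ t : ℝ, iIndepFun (fun n => M.userCount arr ses Set.univ t n) P ∧
      ∀ n, HasLaw (M.userCount arr ses Set.univ t n)
        ((poissonMeasure (M.arrivalRate n * M.meanHoldingTime n).toNNReal).map
          (fun i : ℕ => (i : ℕ∞))) P) ∧
    -- the same distribution is the limit when the network starts empty at time 0
    (∀ y : Fin C → ℕ, Tendsto
      (fun t : ℝ => P {ω | ∀ n, M.userCount arr ses (Set.Ioi 0) t n ω = (y n : ℕ∞)})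
      atTop (𝓝 (ENNReal.ofReal (M.productPoisson y)))) ∧
    -- insensitivity: only the arrival rates and the mean holding times of the cells matter
    (∀ (M' : CellularNetwork C) (Ω' : Type*) [MeasurableSpace Ω'] (P' : Measure Ω')
      [IsProbabilityMeasure P'] (arr' : Fin M'.L → ℕ → Ω' → ℝ)
      (ses' : (l : Fin M'.L) → ℕ → Ω' → Session (M'.N l)),
      M'.IsTraffic P' arr' ses' →
      M'.arrivalRate = M.arrivalRate → M'.meanHoldingTime = M.meanHoldingTime →
      ∀ t t' : ℝ, IdentDistrib (fun ω n => M.userCount arr ses Set.univ t n ω)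
        (fun ω n => M'.userCount arr' ses' Set.univ t' n ω) P P') ∧
    -- it is the stationary distribution of every open M/M/∞ Jackson network with the same
    -- total arrival rates and mean service times, and there is such a network
    (∃ J : OpenJacksonNetwork C, J.Matches M.arrivalRate M.meanHoldingTime) ∧
    (∀ J : OpenJacksonNetwork C, J.Matches M.arrivalRate M.meanHoldingTime →
      ∀ p : (Fin C → ℕ) → ℝ, J.IsStationary p ↔ p = M.productPoisson) := by
  refine ⟨fun t y => ?_, fun t => hM.iIndepFun_userCount t, hM.tendsto_measure_userCount,
    fun M' Ω' _ P' _ arr' ses' hM' hrate hmean t t' => ⟨?_, ?_, ?_⟩,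
    ⟨_, OpenJacksonNetwork.matches_isolated _ _ M.arrivalRate_nonneg
      fun n => M.meanHoldingTime_pos⟩,
    fun J hJ p => hJ.isStationary_iff M.arrivalRate_nonneg p⟩
  · rw [hM.measure_userCount_eq .univ]
    simp_rw [M.toReal_meanUsers_univ]
    rfl
  · exact (measurable_pi_iff.2 fun n => hM.measurable_userCount .univ t n).aemeasurable
  · exact (measurable_pi_iff.2 fun n => hM'.measurable_userCount .univ t' n).aemeasurable
  · rw [hM.map_userCount_univ, hM'.map_userCount_univ, hrate, hmean]
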